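/- Let $\mathcal V$ be a cofibrantly generated closed symmetric monoidal model category with unit $I$: it is complete and cocomplete; the pushout-product of two cofibrations is a cofibration, which is trivial if one of the two is; and for every weak equivalence $Q\to I$ with $Q$ cofibrant and every cofibrant $K$ the map $Q\otimes K\to I\otimes K\cong K$ is a weak equivalence. (The unit itself need not be cofibrant.) Call an object $K\in\mathcal V$ $\mathcal V$-flat if $K\otimes-:\mathcal V\to\mathcal V$ preserves cofibrations and trivial cofibrations, and call a small $\mathcal V$-category locally $\mathcal V$-flat if all its hom-objects are $\mathcal V$-flat. Let $\mathcal D,\mathcal C$ be small locally $\mathcal V$-flat $\mathcal V$-categories and let $F:\mathcal D\to\mathcal C$ be a $\mathcal V$-functor that is surjective on objects. Then the categories $[\mathcal D^{op},\mathcal V]$ and $[\mathcal C^{op},\mathcal V]$ of $\mathcal V$-functors and $\mathcal V$-natural transformations carry projective model structures (fibrations and weak equivalences are pointwise), the restriction functor $F^*:[\mathcal C^{op},\mathcal V]\to[\mathcal D^{op},\mathcal V]$, $X\mapsto X\circ F$, has a left adjoint $F_!$, and $F_!\dashv F^*$ is a Quillen adjunction with respect to the projective model structures. It is a Quillen equivalence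 (that is, for every cofibrant $X\in[\mathcal D^{op},\mathcal V]$ and fibrant $Y\in[\mathcal C^{op},\mathcal V]$ a map $F_!X\to Y$ is a weak equivalence if and only if its adjunct $X\to F^*Y$ is one) if and only if $F$ is homotopically full and faithful, that is, each component $\mathcal D(d',d)\to\mathcal C(Fd',Fd)$ is a weak equivalence in $\mathcal V$. -/

import Mathlib

open CategoryTheory Limits MonoidalCategory HomotopicalAlgebra Opposite
open scoped CategoryTheory.MonoidalClosed

universe v u

section ModelCategories

/-- `A` is small relative to the class `W`: there is a cardinal `κ` such that for every regular
cardinal `μ ≥ κ` the functor `Hom(A, -)` preserves the colimits of all `μ`-sequences whose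
successor maps lie in `W`. -/
def IsSmallRelativeTo {M : Type u} [Category.{v} M] (A : M) (W : MorphismProperty M) : Prop :=
  ∃ κ : Cardinal.{v}, ∀ μ : Cardinal.{v}, κ ≤ μ → ∀ [Fact μ.IsRegular] [OrderBot μ.ord.ToType]
    ⦃X Y : M⦄ (f : X ⟶ Y) (hf : W.TransfiniteCompositionOfShape μ.ord.ToType f),
    PreservesColimit hf.F (coyoneda.obj (op A))

/-- Relative `I`-cell complexes: transfinite compositions of pushouts of coproducts of
elements of `I`. -/
def relativeCells {M : Type u} [Category.{v} M] (I : MorphismProperty M) : MorphismProperty M :=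
  MorphismProperty.transfiniteCompositions.{v} (MorphismProperty.coproducts.{v} I).pushouts

/-- `I` is a (small) set of maps whose domains are small relative to the relative `I`-cell
complexes. -/
def PermitsSmallObjectArgument {M : Type u} [Category.{v} M] (I : MorphismProperty M) : Prop :=
  MorphismProperty.IsSmall.{v} I ∧
    ∀ ⦃A B : M⦄ (i : A ⟶ B), I i → IsSmallRelativeTo A (relativeCells I)

/-- A cofibrantly generated model category: there are sets `I` and `J` of maps permitting the
small object argument that detect the trivial fibrations and the fibrations respectively. -/
def IsCofibrantlyGenerated (M : Type u) [Category.{v} M] [ModelCategory M] : Prop :=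
  ∃ I J : MorphismProperty M, PermitsSmallObjectArgument I ∧ PermitsSmallObjectArgument J ∧
    trivialFibrations M = I.rlp ∧ fibrations M = J.rlp

/-- The compatibility axioms between the monoidal and the model structure in a monoidal model
category: the tensor product is a left Quillen bifunctor, and tensoring a cofibrant replacement of
the unit with a cofibrant object `K` gives a weak equivalence to `K`. -/
structure IsMonoidalModelCategory (V : Type u) [Category.{v} V] [MonoidalCategory V]
    [ModelCategory V] : Prop where
  cofibration_pushoutProduct : ∀ ⦃A B X Y : V⦄ (f : A ⟶ B) (g : X ⟶ Y),
    Cofibration f → Cofibration g →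
      Cofibration ((MonoidalCategory.Arrow.pushoutProduct.obj (Arrow.mk f)).obj (Arrow.mk g)).hom
  weakEquivalence_pushoutProduct : ∀ ⦃A B X Y : V⦄ (f : A ⟶ B) (g : X ⟶ Y),
    Cofibration f → Cofibration g → (WeakEquivalence f ∨ WeakEquivalence g) →
      WeakEquivalence ((MonoidalCategory.Arrow.pushoutProduct.obj (Arrow.mk f)).obj (Arrow.mk g)).hom
  unit_axiom : ∀ ⦃Q : V⦄ (q : Q ⟶ 𝟙_ V), IsCofibrant Q → WeakEquivalence q →
    ∀ K : V, IsCofibrant K → WeakEquivalence (q ▷ K)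

/-- `K` is `V`-flat: `K ⊗ -` preserves cofibrations and trivial cofibrations. -/
structure IsFlatObject {V : Type u} [Category.{v} V] [MonoidalCategory V] [ModelCategory V]
    (K : V) : Prop where
  cofibration : ∀ ⦃X Y : V⦄ (f : X ⟶ Y), Cofibration f → Cofibration (K ◁ f)
  trivialCofibration : ∀ ⦃X Y : V⦄ (f : X ⟶ Y), Cofibration f → WeakEquivalence f →
    Cofibration (K ◁ f) ∧ WeakEquivalence (K ◁ f)

/-- An adjunction between model categories is a Quillen adjunction if the left adjoint preserves
cofibrations and trivial cofibrations. -/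
structure IsQuillenAdjunction {A B : Type*} [Category* A] [Category* B] [ModelCategory A]
    [ModelCategory B] {L : A ⥤ B} {R : B ⥤ A} (_ : L ⊣ R) : Prop where
  cofibration : ∀ ⦃X Y : A⦄ (f : X ⟶ Y), Cofibration f → Cofibration (L.map f)
  trivialCofibration : ∀ ⦃X Y : A⦄ (f : X ⟶ Y), Cofibration f → WeakEquivalence f →
    Cofibration (L.map f) ∧ WeakEquivalence (L.map f)

/-- A Quillen adjunction `L ⊣ R` is a Quillen equivalence if for all cofibrant `X` and fibrant `Y`
a map `L X ⟶ Y` is a weak equivalence if and only if its adjunct `X ⟶ R Y` is one. -/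
structure IsQuillenEquivalence {A B : Type*} [Category* A] [Category* B] [ModelCategory A]
    [ModelCategory B] {L : A ⥤ B} {R : B ⥤ A} (adj : L ⊣ R) : Prop where
  isQuillenAdjunction : IsQuillenAdjunction adj
  weakEquivalence_iff : ∀ ⦃X : A⦄ ⦃Y : B⦄, IsCofibrant X → IsFibrant Y → ∀ f : L.obj X ⟶ Y,
    WeakEquivalence f ↔ WeakEquivalence (adj.homEquiv X Y f)

end ModelCategories

section Presheaves

variable (V : Type u) [Category.{v} V] [MonoidalCategory V] [SymmetricCategory V]
  [MonoidalClosed V]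

/-- The `V`-functors `Cᵒᵖ ⟶ V`, where `V` is enriched over itself by its internal hom.
(A separate type is used because the morphisms of Mathlib's category of enriched functors are only
required to be natural for the underlying ordinary functors.) -/
structure VPresheaf (C : Type v) [EnrichedCategory V C] where
  /-- the underlying `V`-functor -/
  functor : EnrichedFunctor V Cᵒᵖ V

variable {V} {C D : Type v} [EnrichedCategory V C] [EnrichedCategory V D]

/-- The value of a `V`-presheaf at an object. -/
def VPresheaf.val (X : VPresheaf V C) (c : C) : V := X.functor.obj (op c)

/-- The action `C(c', c) ⟶ [X c, X c']` of a `V`-presheaf on hom-objects. -/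
def VPresheaf.act (X : VPresheaf V C) (c c' : C) :
    (c' ⟶[V] c) ⟶ (ihom (X.val c)).obj (X.val c') := X.functor.map (op c) (op c')

/-- A `V`-natural transformation: components `X c ⟶ Y c` in `V` such that the two composites
`C(c', c) ⟶ [X c, X c'] ⟶ [X c, Y c']` and `C(c', c) ⟶ [Y c, Y c'] ⟶ [X c, Y c']` agree. -/
@[ext]
structure VPresheaf.Hom (X Y : VPresheaf V C) where
  /-- the components -/
  app : ∀ c : C, X.val c ⟶ Y.val c
  naturality : ∀ c c' : C,
    X.act c c' ≫ (ihom (X.val c)).map (app c') =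
      Y.act c c' ≫ (MonoidalClosed.pre (app c)).app (Y.val c')

/-- The underlying ordinary category of `[Cᵒᵖ, V]`. -/
instance VPresheaf.category : Category (VPresheaf V C) where
  Hom := VPresheaf.Hom
  id X := { app := fun c => 𝟙 (X.val c), naturality := by simp }
  comp {X Y Z} f g :=
    { app := fun c => f.app c ≫ g.app c
      naturality := fun c c' => by
        rw [Functor.map_comp, ← Category.assoc, f.naturality, Category.assoc,
          MonoidalClosed.pre_comm_ihom_map, ← Category.assoc, g.naturality, Category.assoc,
          MonoidalClosed.pre_map, NatTrans.comp_app] }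
  id_comp f := by ext c; simp
  comp_id f := by ext c; simp
  assoc f g h := by ext c; simp

/-- The `V`-functor `Dᵒᵖ ⟶ Cᵒᵖ` opposite to a `V`-functor `D ⟶ C`. -/
def oppositeVFunctor (F : EnrichedFunctor V D C) : EnrichedFunctor V Dᵒᵖ Cᵒᵖ where
  obj d := op (F.obj d.unop)
  map d d' := F.map d'.unop d.unop
  map_id d := F.map_id d.unop
  map_comp d d' d'' := by
    rw [eComp_op_eq, tensorHom_eComp_op_eq, Category.assoc, F.map_comp]
    rfl

/-- The restriction functor `F^* : [Cᵒᵖ, V] ⥤ [Dᵒᵖ, V]`, `X ↦ X ∘ F`. -/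
def restriction (F : EnrichedFunctor V D C) : VPresheaf V C ⥤ VPresheaf V D where
  obj X := { functor := (oppositeVFunctor F).comp V X.functor }
  map {X Y} f :=
    { app := fun d => f.app (F.obj d)
      naturality := fun d d' => by
        have h := congrArg (fun t => F.map d' d ≫ t) (f.naturality (F.obj d) (F.obj d'))
        simp only [← Category.assoc] at h
        exact h }
  map_id _ := rfl
  map_comp _ _ := rfl

variable [ModelCategory V]

/-- A model structure on `[Cᵒᵖ, V]` is projective if its fibrations and weak equivalences are the
pointwise ones. -/
structure IsProjectiveModelStructure (M : ModelCategory (VPresheaf V C)) : Prop where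
  fibration_iff : ∀ ⦃X Y : VPresheaf V C⦄ (f : X ⟶ Y),
    Fibration f ↔ ∀ c : C, Fibration (f.app c)
  weakEquivalence_iff : ∀ ⦃X Y : VPresheaf V C⦄ (f : X ⟶ Y),
    WeakEquivalence f ↔ ∀ c : C, WeakEquivalence (f.app c)

variable (V C) in
/-- All hom-objects of `C` are `V`-flat. -/
def IsLocallyFlat : Prop := ∀ c c' : C, IsFlatObject (c ⟶[V] c')

/-- Each component `D(d', d) ⟶ C(F d', F d)` is a weak equivalence. -/
def IsHomotopicallyFullyFaithful (F : EnrichedFunctor V D C) : Prop :=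
  ∀ d' d : D, WeakEquivalence (F.map d' d)

end Presheaves

/-! Because `F` is surjective on objects, `F^*` preserves and reflects pointwise weak equivalences.
Being a Quillen equivalence therefore comes down to the unit `X ⟶ F^* F_! X` being a weak
equivalence at cofibrant `X` (`IsQuillenAdjunction.isQuillenEquivalence_iff`).

No induction over cells is needed to study this unit. Evaluation at `c` has a left adjoint `A ↦ C(-,
c) ⊗ A` and a right adjoint `Y ↦ [C(c, -), Y]`, and flatness of the hom-objects makes evaluation
left Quillen. Hence `X ↦ X d` and `X ↦ (F_! X)(F d)` are both left Quillen, and the unit at `d` is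
conjugate to the map `[C(F d, F -), Y] ⟶ [D(d, -), Y]` induced by `F`. If `F` is homotopically fully
faithful, that map is a pointwise weak equivalence for fibrant `Y`, and
`IsQuillenAdjunction.weakEquivalence_of_conjugate` carries this over to the unit. Conversely, at
`D(-, d) ⊗ Q`, with `Q` a cofibrant resolution of the monoidal unit, the unit of the adjunction is
`D(-, d) ⊗ Q ⟶ C(F -, F d) ⊗ Q` up to isomorphism, and tensoring with `Q` detects weak equivalences
between flat objects.

Neither flat objects nor the monoidal unit need be cofibrant, so the homotopical core is
`weakEquivalence_whiskerLeft_resolution`: `K ⊗ Q ⟶ K` is a weak equivalence for flat `K`. It follows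
from the two out of six property, which rests on the fact that maps inverted in the homotopy
category are weak equivalences.

The projective model structure is generated by the free presheaf maps on the generators of `V`.
Evaluating a cell complex of such maps gives a transfinite composition of maps that only have the
left lifting property, not of cells, so smallness must first be extended to this larger class
(`IsSmallRelativeTo.llp_rlp`). The functor `F_!` exists because every presheaf is a colimit of free
ones, on which its value is explicit. -/

/-! ### Presheaves as left modules over the hom-objects -/

section LeftAction

variable {V : Type u} [Category.{v} V] [MonoidalCategory V] [SymmetricCategory V]

/-- By the hexagon identities and naturality: both sides reverse the order of the three factors. -/
lemma braiding_whiskerRight_braiding (x K K' : V) :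
    (α_ x K K').inv ≫ (β_ x K).hom ▷ K' ≫ (β_ (K ⊗ x) K').hom =
      (β_ x (K ⊗ K')).hom ≫ (β_ K K').hom ▷ x ≫ (α_ K' K x).hom := by
  simp [BraidedCategory.braiding_tensor_left_hom, BraidedCategory.braiding_tensor_right_hom]

variable [MonoidalClosed V]

/-- Translates composition of internal homs, whose uncurried form acts from the right, into left
actions. The remaining braiding of `K` and `K'` is the one occurring in the composition of the
opposite enriched category. -/
lemma uncurry_tensorHom_comp {x y z K K' : V} (a : K ⟶ (ihom x).obj y) (b : K' ⟶ (ihom y).obj z)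
    (la : K ⊗ x ⟶ y) (lb : K' ⊗ y ⟶ z) (ha : MonoidalClosed.uncurry a = (β_ _ _).hom ≫ la)
    (hb : MonoidalClosed.uncurry b = (β_ _ _).hom ≫ lb) :
    MonoidalClosed.uncurry ((a ⊗ₘ b) ≫ MonoidalClosed.comp x y z) =
      (β_ x (K ⊗ K')).hom ≫ (β_ K K').hom ▷ x ≫ (α_ K' K x).hom ≫ K' ◁ la ≫ lb := by
  have e : MonoidalClosed.uncurry ((a ⊗ₘ b) ≫ MonoidalClosed.comp x y z) =
      (α_ x K K').inv ≫ MonoidalClosed.uncurry a ▷ K' ≫ MonoidalClosed.uncurry b := by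
    rw [MonoidalClosed.uncurry_natural_left, MonoidalClosed.comp_eq, MonoidalClosed.uncurry_curry,
      MonoidalClosed.compTranspose_eq, MonoidalClosed.uncurry_eq, MonoidalClosed.uncurry_eq,
      MonoidalCategory.tensorHom_def, whiskerLeft_comp, Category.assoc, comp_whiskerRight,
      Category.assoc, associator_inv_naturality_right_assoc, whisker_exchange_assoc,
      associator_inv_naturality_middle_assoc]
    rfl
  rw [e, ha, hb, comp_whiskerRight, Category.assoc,
    BraidedCategory.braiding_naturality_left_assoc, ← reassoc_of% braiding_whiskerRight_braiding]

variable {C D : Type v} [EnrichedCategory V C] [EnrichedCategory V D]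

namespace VPresheaf

/-- The left action `C(c', c) ⊗ X c ⟶ X c'` of hom-objects on the values of a `V`-presheaf. -/
def lact (X : VPresheaf V C) (c c' : C) : (c' ⟶[V] c) ⊗ X.val c ⟶ X.val c' :=
  (β_ _ _).hom ≫ MonoidalClosed.uncurry (X.act c c')

lemma uncurry_act (X : VPresheaf V C) (c c' : C) :
    MonoidalClosed.uncurry (X.act c c') = (β_ _ _).hom ≫ X.lact c c' := by
  simp [lact]

lemma lact_id (X : VPresheaf V C) (c : C) :
    eId V c ▷ X.val c ≫ X.lact c c = (λ_ (X.val c)).hom := by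
  have h : eId V c ≫ X.act c c = MonoidalClosed.id (X.val c) := X.functor.map_id (op c)
  rw [lact, BraidedCategory.braiding_naturality_left_assoc, ← MonoidalClosed.uncurry_natural_left,
    h, MonoidalClosed.id_eq, MonoidalClosed.uncurry_curry, braiding_tensorUnit_left]
  simp

/-- Functoriality on `Cᵒᵖ` involves the braiding of the two hom-objects. It cancels against the one
produced by `uncurry_tensorHom_comp`, leaving an ordinary associativity law. -/
lemma lact_comp (X : VPresheaf V C) (c c' c'' : C) :
    eComp V c'' c' c ▷ X.val c ≫ X.lact c c'' =
      (α_ _ _ _).hom ≫ (c'' ⟶[V] c') ◁ X.lact c c' ≫ X.lact c' c'' := by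
  have h : (β_ (c' ⟶[V] c) (c'' ⟶[V] c')).hom ≫ eComp V c'' c' c ≫ X.act c c'' =
      (X.act c c' ⊗ₘ X.act c' c'') ≫ MonoidalClosed.comp _ _ _ := by
    have := X.functor.map_comp (op c) (op c') (op c'')
    rw [eComp_op_eq, Category.assoc] at this
    exact this
  have h' := congrArg MonoidalClosed.uncurry h
  rw [uncurry_tensorHom_comp _ _ _ _ (uncurry_act X c c') (uncurry_act X c' c''),
    MonoidalClosed.uncurry_natural_left, MonoidalClosed.uncurry_natural_left, uncurry_act,
    BraidedCategory.braiding_naturality_right_assoc,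
    BraidedCategory.braiding_naturality_right_assoc, cancel_epi, cancel_epi] at h'
  exact h'

lemma Hom.lact_naturality {X Y : VPresheaf V C} (f : X ⟶ Y) (c c' : C) :
    X.lact c c' ≫ f.app c' = (c' ⟶[V] c) ◁ f.app c ≫ Y.lact c c' := by
  have h := congrArg MonoidalClosed.uncurry (f.naturality c c')
  rw [MonoidalClosed.uncurry_natural_right, MonoidalClosed.uncurry_pre_app, uncurry_act,
    uncurry_act, Category.assoc, BraidedCategory.braiding_naturality_left_assoc, cancel_epi] at h
  exact h

/-- A morphism of `V`-presheaves from components commuting with the left actions. -/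
def homMk {X Y : VPresheaf V C} (app : ∀ c, X.val c ⟶ Y.val c)
    (w : ∀ c c', X.lact c c' ≫ app c' = (c' ⟶[V] c) ◁ app c ≫ Y.lact c c') : X ⟶ Y :=
  { app := app
    naturality := fun c c' => MonoidalClosed.uncurry_injective (by
      rw [MonoidalClosed.uncurry_natural_right, MonoidalClosed.uncurry_pre_app, uncurry_act,
        uncurry_act, Category.assoc, BraidedCategory.braiding_naturality_left_assoc, w]) :
    VPresheaf.Hom X Y }

lemma hom_ext {X Y : VPresheaf V C} {f g : X ⟶ Y} (h : ∀ c, f.app c = g.app c) : f = g :=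
  Hom.ext (funext h)

variable (V C) in
/-- A family of objects of `V` with a left action of the hom-objects of `C`. -/
structure LeftModule where
  /-- the underlying objects -/
  val : C → V
  /-- the action -/
  lact : ∀ c c' : C, (c' ⟶[V] c) ⊗ val c ⟶ val c'
  lact_id : ∀ c, eId V c ▷ val c ≫ lact c c = (λ_ (val c)).hom
  lact_comp : ∀ c c' c'' : C, eComp V c'' c' c ▷ val c ≫ lact c c'' =
    (α_ _ _ _).hom ≫ (c'' ⟶[V] c') ◁ lact c c' ≫ lact c' c''

/-- The map `C(c', c) ⟶ [M c, M c']` corresponding to the action. -/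
def LeftModule.act (M : LeftModule V C) (c c' : C) :
    (c' ⟶[V] c) ⟶ (ihom (M.val c)).obj (M.val c') :=
  MonoidalClosed.curry ((β_ _ _).hom ≫ M.lact c c')

lemma LeftModule.uncurry_act (M : LeftModule V C) (c c' : C) :
    MonoidalClosed.uncurry (M.act c c') = (β_ _ _).hom ≫ M.lact c c' :=
  MonoidalClosed.uncurry_curry _

lemma LeftModule.act_id (M : LeftModule V C) (c : C) :
    eId V c ≫ M.act c c = MonoidalClosed.id (M.val c) :=
  MonoidalClosed.uncurry_injective (by
    rw [MonoidalClosed.id_eq, MonoidalClosed.uncurry_curry, MonoidalClosed.uncurry_natural_left,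
      M.uncurry_act, BraidedCategory.braiding_naturality_right_assoc, M.lact_id]
    simp [braiding_tensorUnit_right])

lemma LeftModule.act_comp (M : LeftModule V C) (c c' c'' : C) :
    ((β_ (c' ⟶[V] c) (c'' ⟶[V] c')).hom ≫ eComp V c'' c' c) ≫ M.act c c'' =
      (M.act c c' ⊗ₘ M.act c' c'') ≫ MonoidalClosed.comp _ _ _ :=
  MonoidalClosed.uncurry_injective (by
    rw [uncurry_tensorHom_comp _ _ _ _ (M.uncurry_act c c') (M.uncurry_act c' c''),
      ← M.lact_comp, MonoidalClosed.uncurry_natural_left, M.uncurry_act,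
      BraidedCategory.braiding_naturality_right_assoc, comp_whiskerRight, Category.assoc])

/-- The `V`-presheaf attached to a left module. -/
def ofLeftModule (M : LeftModule V C) : VPresheaf V C where
  functor :=
    { obj := fun c => M.val c.unop
      map := fun c c' => M.act c.unop c'.unop
      map_id := fun c => M.act_id c.unop
      map_comp := fun c c' c'' => M.act_comp c.unop c'.unop c''.unop }

lemma ofLeftModule_lact (M : LeftModule V C) (c c' : C) :
    (ofLeftModule M).lact c c' = M.lact c c' := by
  have : (β_ (c' ⟶[V] c) (M.val c)).hom ≫ MonoidalClosed.uncurry (M.act c c') = M.lact c c' := by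
    simp [M.uncurry_act]
  exact this

lemma restriction_lact (F : EnrichedFunctor V D C) (X : VPresheaf V C) (d d' : D) :
    ((restriction F).obj X).lact d d' = F.map d' d ▷ _ ≫ X.lact (F.obj d) (F.obj d') := by
  have : (β_ (d' ⟶[V] d) (X.val (F.obj d))).hom ≫
      MonoidalClosed.uncurry (F.map d' d ≫ X.act (F.obj d) (F.obj d')) =
      F.map d' d ▷ _ ≫ X.lact (F.obj d) (F.obj d') := by
    rw [MonoidalClosed.uncurry_natural_left, uncurry_act,
      BraidedCategory.braiding_naturality_right_assoc]
    simp
  exact this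

variable (V) in
/-- Evaluation of `V`-presheaves at an object. -/
@[simps]
def evaluation (c : C) : VPresheaf V C ⥤ V where
  obj X := X.val c
  map f := f.app c

end VPresheaf
end LeftAction

/-! ### Pointwise limits and colimits of presheaves -/

section PresheafLimits

variable {V : Type u} [Category.{v} V] [MonoidalCategory V] [SymmetricCategory V]
  [MonoidalClosed V] {C D : Type v} [EnrichedCategory V C] [EnrichedCategory V D]

namespace VPresheaf

/-- A morphism to the presheaf attached to a left module. -/
def homToOfLeftModule {X : VPresheaf V C} {M : LeftModule V C} (app : ∀ c, X.val c ⟶ M.val c)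
    (w : ∀ c c', X.lact c c' ≫ app c' = (c' ⟶[V] c) ◁ app c ≫ M.lact c c') :
    X ⟶ ofLeftModule M :=
  homMk (Y := ofLeftModule M) app fun c c' => by
    rw [ofLeftModule_lact]
    exact w c c'

/-- A morphism from the presheaf attached to a left module. -/
def homFromOfLeftModule {X : VPresheaf V C} {M : LeftModule V C} (app : ∀ c, M.val c ⟶ X.val c)
    (w : ∀ c c', M.lact c c' ≫ app c' = (c' ⟶[V] c) ◁ app c ≫ X.lact c c') :
    ofLeftModule M ⟶ X :=
  homMk (X := ofLeftModule M) app fun c c' => by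
    rw [ofLeftModule_lact]
    exact w c c'

section Limits

variable {J : Type*} [Category* J] (G : J ⥤ VPresheaf V C)

section

variable [HasLimitsOfShape J V]

/-- The values of the pointwise limit. -/
noncomputable def limitVal (c : C) : V := limit (G ⋙ evaluation V c)

/-- The projections of the pointwise limit. -/
noncomputable def limitπ (c : C) (j : J) : limitVal G c ⟶ (G.obj j).val c :=
  limit.π (G ⋙ evaluation V c) j

lemma limitπ_w (c : C) {i j : J} (f : i ⟶ j) :
    limitπ G c i ≫ (G.map f).app c = limitπ G c j :=
  limit.w (G ⋙ evaluation V c) f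

lemma limitVal_hom_ext {c : C} {Z : V} {f g : Z ⟶ limitVal G c}
    (h : ∀ j, f ≫ limitπ G c j = g ≫ limitπ G c j) : f = g :=
  limit.hom_ext h

/-- The universal property of the pointwise limit. -/
noncomputable def limitLift (c : C) {Z : V} (f : ∀ j, Z ⟶ (G.obj j).val c)
    (w : ∀ ⦃i j : J⦄ (φ : i ⟶ j), f i ≫ (G.map φ).app c = f j) : Z ⟶ limitVal G c :=
  limit.lift (G ⋙ evaluation V c)
    { pt := Z
      π :=
        { app := f
          naturality := fun _ j φ => (Category.id_comp (f j)).trans (w φ).symm } }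

@[simp]
lemma limitLift_π (c : C) {Z : V} (f : ∀ j, Z ⟶ (G.obj j).val c) (w) (j : J) :
    limitLift G c f w ≫ limitπ G c j = f j :=
  limit.lift_π _ _

/-- The action on the pointwise limit. -/
noncomputable def limitLact (c c' : C) : (c' ⟶[V] c) ⊗ limitVal G c ⟶ limitVal G c' :=
  limitLift G c' (fun j => (c' ⟶[V] c) ◁ limitπ G c j ≫ (G.obj j).lact c c')
    (fun i j φ => by
      rw [Category.assoc, (G.map φ).lact_naturality c c', ← whiskerLeft_comp_assoc, limitπ_w])

@[simp]
lemma limitLact_π (c c' : C) (j : J) :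
    limitLact G c c' ≫ limitπ G c' j = (c' ⟶[V] c) ◁ limitπ G c j ≫ (G.obj j).lact c c' :=
  limitLift_π _ _ _ _ _

/-- The pointwise limit, as a left module. -/
noncomputable def limitModule : LeftModule V C where
  val := limitVal G
  lact := limitLact G
  lact_id := fun c => limitVal_hom_ext G fun j => by
    rw [Category.assoc, limitLact_π, ← whisker_exchange_assoc, lact_id, leftUnitor_naturality]
  lact_comp := fun c c' c'' => limitVal_hom_ext G fun j => by
    simp only [Category.assoc, limitLact_π]
    rw [← whisker_exchange_assoc, lact_comp, ← whiskerLeft_comp_assoc, limitLact_π,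
      whiskerLeft_comp_assoc, associator_naturality_right_assoc]

/-- The projections from the pointwise limit. -/
noncomputable def pointwiseLimitπ (j : J) : ofLeftModule (limitModule G) ⟶ G.obj j :=
  homFromOfLeftModule (fun c => limitπ G c j) (fun c c' => limitLact_π G c c' j)

/-- The pointwise limit cone. -/
noncomputable def pointwiseLimitCone : Cone G where
  pt := ofLeftModule (limitModule G)
  π :=
    { app := pointwiseLimitπ G
      naturality := fun _ _ f => (Category.id_comp _).trans
        (hom_ext (f := pointwiseLimitπ G _ ≫ G.map f) (g := pointwiseLimitπ G _) fun c => limitπ_w G c f).symm }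

/-- The lift of a cone to the pointwise limit. -/
noncomputable def pointwiseLimitLift (s : Cone G) : s.pt ⟶ ofLeftModule (limitModule G) :=
  homToOfLeftModule
    (fun c => limitLift G c (fun j => (s.π.app j).app c)
      (fun _ _ φ => congrArg (fun t => Hom.app t c) (s.w φ)))
    (fun c c' => limitVal_hom_ext G fun j => by
      have h := (s.π.app j).lact_naturality c c'
      dsimp only [limitModule]
      simp only [Category.assoc, limitLact_π, limitLift_π]
      rw [← whiskerLeft_comp_assoc, limitLift_π]
      exact h)

lemma pointwiseLimitLift_app_π (s : Cone G) (c : C) (j : J) :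
    (pointwiseLimitLift G s).app c ≫ limitπ G c j = (s.π.app j).app c :=
  limitLift_π G c (Z := s.pt.val c) (fun j => (s.π.app j).app c)
    (fun _ _ φ => congrArg (fun t => Hom.app t c) (s.w φ)) j

/-- `pointwiseLimitCone G` is a limit cone. -/
noncomputable def isLimitPointwiseLimitCone : IsLimit (pointwiseLimitCone G) where
  lift := pointwiseLimitLift G
  fac s j := hom_ext fun c => pointwiseLimitLift_app_π G s c j
  uniq s m hm := hom_ext fun c =>
    limitVal_hom_ext G (f := m.app c) (g := (pointwiseLimitLift G s).app c) fun j =>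
      (congrArg (fun t => Hom.app t c) (hm j)).trans (pointwiseLimitLift_app_π G s c j).symm

instance : HasLimitsOfShape J (VPresheaf V C) where
  has_limit G := ⟨⟨⟨_, isLimitPointwiseLimitCone G⟩⟩⟩

end

section

variable [HasColimitsOfShape J V]

/-- The values of the pointwise colimit. -/
noncomputable def colimitVal (c : C) : V := colimit (G ⋙ evaluation V c)

/-- The inclusions into the pointwise colimit. -/
noncomputable def colimitι (c : C) (j : J) : (G.obj j).val c ⟶ colimitVal G c :=
  colimit.ι (G ⋙ evaluation V c) j

lemma colimitι_w (c : C) {i j : J} (f : i ⟶ j) :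
    (G.map f).app c ≫ colimitι G c j = colimitι G c i :=
  colimit.w (G ⋙ evaluation V c) f

/-- Tensoring with `K` preserves the pointwise colimits. -/
noncomputable def isColimitTensorColimitVal (K : V) (c : C) :
    -- Closedness enters here: `K ⊗ -` is a left adjoint, so the actions pass to the colimit.
    IsColimit ((tensorLeft K).mapCocone (colimit.cocone (G ⋙ evaluation V c))) :=
  isColimitOfPreserves (tensorLeft K) (colimit.isColimit _)

lemma tensor_colimitVal_hom_ext {K Z : V} {c : C} {f g : K ⊗ colimitVal G c ⟶ Z}
    (h : ∀ j, K ◁ colimitι G c j ≫ f = K ◁ colimitι G c j ≫ g) : f = g :=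
  (isColimitTensorColimitVal G K c).hom_ext h

lemma colimitVal_hom_ext {c : C} {Z : V} {f g : colimitVal G c ⟶ Z}
    (h : ∀ j, colimitι G c j ≫ f = colimitι G c j ≫ g) : f = g :=
  colimit.hom_ext h

/-- The universal property of the pointwise colimit. -/
noncomputable def colimitDesc (c : C) {Z : V} (f : ∀ j, (G.obj j).val c ⟶ Z)
    (w : ∀ ⦃i j : J⦄ (φ : i ⟶ j), (G.map φ).app c ≫ f j = f i) : colimitVal G c ⟶ Z :=
  colimit.desc (G ⋙ evaluation V c)
    { pt := Z
      ι :=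
        { app := f
          naturality := fun i _ φ => (w φ).trans (Category.comp_id (f i)).symm } }

@[simp]
lemma ι_colimitDesc (c : C) {Z : V} (f : ∀ j, (G.obj j).val c ⟶ Z) (w) (j : J) :
    colimitι G c j ≫ colimitDesc G c f w = f j :=
  colimit.ι_desc _ _

/-- The universal property of the pointwise colimit tensored with an object. -/
noncomputable def tensorColimitDesc (K : V) (c : C) {Z : V} (f : ∀ j, K ⊗ (G.obj j).val c ⟶ Z)
    (w : ∀ ⦃i j : J⦄ (φ : i ⟶ j), K ◁ (G.map φ).app c ≫ f j = f i) :
    K ⊗ colimitVal G c ⟶ Z :=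
  (isColimitTensorColimitVal G K c).desc
    { pt := Z
      ι :=
        { app := f
          naturality := fun i _ φ => (w φ).trans (Category.comp_id (f i)).symm } }

@[simp]
lemma ι_tensorColimitDesc (K : V) (c : C) {Z : V} (f : ∀ j, K ⊗ (G.obj j).val c ⟶ Z) (w) (j : J) :
    K ◁ colimitι G c j ≫ tensorColimitDesc G K c f w = f j :=
  (isColimitTensorColimitVal G K c).fac _ j

/-- The action on the pointwise colimit. -/
noncomputable def colimitLact (c c' : C) : (c' ⟶[V] c) ⊗ colimitVal G c ⟶ colimitVal G c' :=
  tensorColimitDesc G _ c (fun j => (G.obj j).lact c c' ≫ colimitι G c' j)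
    (fun i j φ => by
      rw [← reassoc_of% (G.map φ).lact_naturality c c', colimitι_w])

@[simp]
lemma ι_colimitLact (c c' : C) (j : J) :
    (c' ⟶[V] c) ◁ colimitι G c j ≫ colimitLact G c c' = (G.obj j).lact c c' ≫ colimitι G c' j :=
  ι_tensorColimitDesc _ _ _ _ _ _

/-- The pointwise colimit, as a left module. -/
noncomputable def colimitModule : LeftModule V C where
  val := colimitVal G
  lact := colimitLact G
  lact_id := fun c => tensor_colimitVal_hom_ext G fun j => by
    rw [whisker_exchange_assoc, ι_colimitLact, reassoc_of% (G.obj j).lact_id c,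
      leftUnitor_naturality]
  lact_comp := fun c c' c'' => tensor_colimitVal_hom_ext G fun j => by
    rw [whisker_exchange_assoc, ι_colimitLact, associator_naturality_right_assoc,
      ← whiskerLeft_comp_assoc, ι_colimitLact, whiskerLeft_comp_assoc, ι_colimitLact,
      reassoc_of% (G.obj j).lact_comp c c' c'']

/-- The inclusions into the pointwise colimit. -/
noncomputable def pointwiseColimitι (j : J) : G.obj j ⟶ ofLeftModule (colimitModule G) :=
  homToOfLeftModule (fun c => colimitι G c j) (fun c c' => (ι_colimitLact G c c' j).symm)

/-- The pointwise colimit cocone. -/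
noncomputable def pointwiseColimitCocone : Cocone G where
  pt := ofLeftModule (colimitModule G)
  ι :=
    { app := pointwiseColimitι G
      naturality := fun _ _ f =>
        (hom_ext (f := G.map f ≫ pointwiseColimitι G _) (g := pointwiseColimitι G _) fun c => colimitι_w G c f).trans
          (Category.comp_id _).symm }

/-- The morphism from the pointwise colimit attached to a cocone. -/
noncomputable def pointwiseColimitDesc (s : Cocone G) : ofLeftModule (colimitModule G) ⟶ s.pt :=
  homFromOfLeftModule
    (fun c => colimitDesc G c (fun j => (s.ι.app j).app c)
      (fun _ _ φ => congrArg (fun t => Hom.app t c) (s.w φ)))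
    (fun c c' => tensor_colimitVal_hom_ext G fun j => by
      have h := (s.ι.app j).lact_naturality c c'
      dsimp only [colimitModule]
      rw [reassoc_of% ι_colimitLact G c c' j, ι_colimitDesc, ← whiskerLeft_comp_assoc, ι_colimitDesc]
      exact h)

lemma ι_pointwiseColimitDesc_app (s : Cocone G) (c : C) (j : J) :
    colimitι G c j ≫ (pointwiseColimitDesc G s).app c = (s.ι.app j).app c :=
  ι_colimitDesc G c (Z := s.pt.val c) (fun j => (s.ι.app j).app c)
    (fun _ _ φ => congrArg (fun t => Hom.app t c) (s.w φ)) j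

/-- `pointwiseColimitCocone G` is a colimit cocone. -/
noncomputable def isColimitPointwiseColimitCocone : IsColimit (pointwiseColimitCocone G) where
  desc := pointwiseColimitDesc G
  fac s j := hom_ext fun c => ι_pointwiseColimitDesc_app G s c j
  uniq s m hm := hom_ext fun c =>
    colimitVal_hom_ext G (f := m.app c) (g := (pointwiseColimitDesc G s).app c) fun j =>
      (congrArg (fun t => Hom.app t c) (hm j)).trans (ι_pointwiseColimitDesc_app G s c j).symm

instance : HasColimitsOfShape J (VPresheaf V C) where
  has_colimit G := ⟨⟨⟨_, isColimitPointwiseColimitCocone G⟩⟩⟩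

end

end Limits

end VPresheaf
end PresheafLimits

/-! ### The left and right adjoints of evaluation -/

section FreeAndCofree

variable {V : Type u} [Category.{v} V] [MonoidalCategory V]
  {C D : Type v} [EnrichedCategory V C] [EnrichedCategory V D]

namespace VPresheaf

section Free

lemma eId_whiskerRight_eComp (c c' : C) (A : V) :
    (α_ _ _ A).inv ≫ eId V c ▷ (c ⟶[V] c') ▷ A ≫ eComp V c c c' ▷ A = (λ_ _).hom := by
  have h : eId V c ▷ (c ⟶[V] c') ≫ eComp V c c c' = (λ_ _).hom := by
    rw [← cancel_epi (λ_ (c ⟶[V] c')).inv, e_id_comp, Iso.inv_hom_id]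
  rw [← comp_whiskerRight, h]
  simp

lemma eComp_eId_whiskerRight (c c' : C) (A : V) :
    (c ⟶[V] c') ◁ ((λ_ A).inv ≫ eId V c' ▷ A) ≫ (α_ _ _ _).inv ≫ eComp V c c' c' ▷ A = 𝟙 _ := by
  have h : (c ⟶[V] c') ◁ eId V c' ≫ eComp V c c' c' = (ρ_ _).hom := by
    rw [← cancel_epi (ρ_ (c ⟶[V] c')).inv, e_comp_id, Iso.inv_hom_id]
  rw [whiskerLeft_comp, Category.assoc, associator_inv_naturality_middle_assoc,
    ← comp_whiskerRight, h]
  simp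

lemma eComp_assoc_whiskerRight (w x y z : C) (A : V) :
    (α_ (w ⟶[V] x) (x ⟶[V] y) ((y ⟶[V] z) ⊗ A)).hom ≫
        (w ⟶[V] x) ◁ ((α_ _ _ _).inv ≫ eComp V x y z ▷ A) ≫ (α_ _ _ _).inv ≫ eComp V w x z ▷ A =
      eComp V w x y ▷ ((y ⟶[V] z) ⊗ A) ≫ (α_ _ _ _).inv ≫ eComp V w y z ▷ A := by
  have h := congrArg (fun t => t ▷ A) (e_assoc V w x y z)
  simp only [comp_whiskerRight] at h
  rw [associator_inv_naturality_left_assoc, whiskerLeft_comp, Category.assoc,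
    associator_inv_naturality_middle_assoc, ← h]
  simp

variable [SymmetricCategory V] [MonoidalClosed V]

omit [SymmetricCategory V] [MonoidalClosed V] in
lemma eComp_whiskerRight_naturality (c c' c'' : C) {A B : V} (f : A ⟶ B) :
    ((α_ (c'' ⟶[V] c') (c' ⟶[V] c) A).inv ≫ eComp V c'' c' c ▷ A) ≫ (c'' ⟶[V] c) ◁ f =
      (c'' ⟶[V] c') ◁ (c' ⟶[V] c) ◁ f ≫ (α_ _ _ _).inv ≫ eComp V c'' c' c ▷ B := by
  rw [Category.assoc, ← whisker_exchange, associator_inv_naturality_right_assoc]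

/-- The left module `C(-, c) ⊗ A`. -/
def freeModule (c : C) (A : V) : LeftModule V C where
  val := fun c' => (c' ⟶[V] c) ⊗ A
  lact := fun c' c'' => (α_ _ _ _).inv ≫ eComp V c'' c' c ▷ A
  lact_id := fun c' => by
    rw [associator_inv_naturality_left_assoc, eId_whiskerRight_eComp]
  lact_comp := fun c' c'' c''' => (eComp_assoc_whiskerRight _ _ _ _ _).symm

/-- The functor `A ↦ C(-, c) ⊗ A`. -/
def free (c : C) : V ⥤ VPresheaf V C where
  obj A := ofLeftModule (freeModule c A)
  map {A B} f := homToOfLeftModule (X := ofLeftModule (freeModule c A)) (fun c' => (c' ⟶[V] c) ◁ f)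
    (fun c' c'' => by
      rw [ofLeftModule_lact]
      exact eComp_whiskerRight_naturality c c' c'' f)
  map_id A := hom_ext fun c' => whiskerLeft_id _ _
  map_comp f g := hom_ext fun c' => whiskerLeft_comp _ _ _

lemma free_obj_lact (c : C) (A : V) (c' c'' : C) :
    ((free c).obj A).lact c' c'' = (α_ _ _ _).inv ≫ eComp V c'' c' c ▷ A :=
  ofLeftModule_lact _ _ _

/-- The morphism `C(-, c) ⊗ A ⟶ X` attached to `A ⟶ X c`. -/
def freeDesc {c : C} {A : V} {X : VPresheaf V C} (g : A ⟶ X.val c) : (free c).obj A ⟶ X :=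
  homFromOfLeftModule (fun c' => (c' ⟶[V] c) ◁ g ≫ X.lact c c') (fun c' c'' => by
    simp only [freeModule, Category.assoc, whiskerLeft_comp]
    rw [← whisker_exchange_assoc, lact_comp, associator_naturality_right_assoc,
      Iso.inv_hom_id_assoc])

@[simp]
lemma freeDesc_app {c : C} {A : V} {X : VPresheaf V C} (g : A ⟶ X.val c) (c' : C) :
    (freeDesc g).app c' = (c' ⟶[V] c) ◁ g ≫ X.lact c c' := rfl

/-- The canonical morphism `A ⟶ C(c, c) ⊗ A`. -/
def freeUnit (c : C) (A : V) : A ⟶ ((free c).obj A).val c :=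
  (λ_ A).inv ≫ eId V c ▷ A

lemma freeUnit_freeDesc {c : C} {A : V} {X : VPresheaf V C} (g : A ⟶ X.val c) :
    freeUnit c A ≫ (freeDesc g).app c = g := by
  have : ((λ_ A).inv ≫ eId V c ▷ A) ≫ (c ⟶[V] c) ◁ g ≫ X.lact c c = g := by
    rw [Category.assoc, ← whisker_exchange_assoc, lact_id, leftUnitor_naturality,
      Iso.inv_hom_id_assoc]
  exact this

/-- The Yoneda argument: the free presheaf is generated under the action by the copy of `A` over the
identity of `c`, so morphisms out of it are determined by their restriction to `A`. -/
lemma freeUnit_lact (c c' : C) (A : V) :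
    (c' ⟶[V] c) ◁ freeUnit c A ≫ ((free c).obj A).lact c c' = 𝟙 _ := by
  rw [free_obj_lact]
  exact eComp_eId_whiskerRight _ _ _

lemma freeDesc_freeUnit {c : C} {A : V} {X : VPresheaf V C} (f : (free c).obj A ⟶ X) :
    freeDesc (freeUnit c A ≫ f.app c) = f := hom_ext fun c' => by
  rw [freeDesc_app, whiskerLeft_comp, Category.assoc, ← f.lact_naturality,
    ← Category.assoc, freeUnit_lact]
  exact Category.id_comp _

/-- `A ↦ C(-, c) ⊗ A` is left adjoint to evaluation at `c`. -/
def freeAdjunction (c : C) : free (V := V) c ⊣ evaluation V c :=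
  Adjunction.mkOfHomEquiv
    { homEquiv := fun A X =>
        { toFun := fun f => freeUnit c A ≫ f.app c
          invFun := fun g => freeDesc g
          left_inv := fun f => freeDesc_freeUnit f
          right_inv := fun g => freeUnit_freeDesc g }
      homEquiv_naturality_left_symm := fun f g => hom_ext fun c' => by
        exact (congrArg (· ≫ _) (whiskerLeft_comp _ _ _)).trans (Category.assoc _ _ _)
      homEquiv_naturality_right := fun f g => (Category.assoc _ _ _).symm }

lemma freeAdjunction_homEquiv_symm_apply (c : C) {A : V} {X : VPresheaf V C}
    (g : A ⟶ X.val c) : ((freeAdjunction c).homEquiv A X).symm g = freeDesc g := by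
  rw [freeAdjunction, Adjunction.mkOfHomEquiv_homEquiv]
  rfl

end Free

section Cofree

variable [SymmetricCategory V] [MonoidalClosed V]

/-- The action on `[C(c, -), Y]`. -/
def cofreeLact (c : C) (Y : V) (c' c'' : C) :
    (c'' ⟶[V] c') ⊗ (ihom (c ⟶[V] c')).obj Y ⟶ (ihom (c ⟶[V] c'')).obj Y :=
  MonoidalClosed.curry ((α_ _ _ _).inv ≫ eComp V c c'' c' ▷ _ ≫ (ihom.ev _).app Y)

omit [SymmetricCategory V] in
lemma whiskerLeft_cofreeLact_ev (c : C) (Y : V) (c' c'' : C) :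
    (c ⟶[V] c'') ◁ cofreeLact c Y c' c'' ≫ (ihom.ev _).app Y =
      (α_ _ _ _).inv ≫ eComp V c c'' c' ▷ _ ≫ (ihom.ev _).app Y := by
  rw [← MonoidalClosed.uncurry_eq, cofreeLact, MonoidalClosed.uncurry_curry]

omit [SymmetricCategory V] in
lemma cofreeLact_naturality (c : C) {Y Z : V} (f : Y ⟶ Z) (c' c'' : C) :
    cofreeLact c Y c' c'' ≫ (ihom _).map f =
      (c'' ⟶[V] c') ◁ (ihom _).map f ≫ cofreeLact c Z c' c'' :=
  MonoidalClosed.uncurry_injective (by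
    rw [MonoidalClosed.uncurry_natural_right, MonoidalClosed.uncurry_natural_left,
      MonoidalClosed.uncurry_eq, MonoidalClosed.uncurry_eq, whiskerLeft_cofreeLact_ev,
      whiskerLeft_cofreeLact_ev, Category.assoc, Category.assoc]
    have h := ihom.ev_naturality (c ⟶[V] c') f
    rw [← h, associator_inv_naturality_right_assoc, whisker_exchange_assoc])

/-- The left module `[C(c, -), Y]`. -/
def cofreeModule (c : C) (Y : V) : LeftModule V C where
  val := fun c' => (ihom (c ⟶[V] c')).obj Y
  lact := cofreeLact c Y
  lact_id := fun c' => MonoidalClosed.uncurry_injective (by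
    rw [MonoidalClosed.uncurry_natural_left, MonoidalClosed.uncurry_eq, whiskerLeft_cofreeLact_ev,
      MonoidalClosed.uncurry_eq]
    have h := eComp_eId_whiskerRight c c' ((ihom (c ⟶[V] c')).obj Y)
    rw [whiskerLeft_comp, Category.assoc] at h
    rw [← cancel_epi ((c ⟶[V] c') ◁ (λ_ ((ihom (c ⟶[V] c')).obj Y)).inv), reassoc_of% h,
      ← whiskerLeft_comp_assoc, Iso.inv_hom_id, whiskerLeft_id, Category.id_comp])
  lact_comp := fun c' c'' c''' => MonoidalClosed.uncurry_injective (by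
    simp only [MonoidalClosed.uncurry_natural_left]
    have h := congrArg (fun t => t ▷ (ihom (c ⟶[V] c')).obj Y) (e_assoc V c c''' c'' c')
    simp only [comp_whiskerRight] at h
    rw [MonoidalClosed.uncurry_eq, whiskerLeft_cofreeLact_ev,
      MonoidalClosed.uncurry_eq, whiskerLeft_cofreeLact_ev, associator_inv_naturality_right_assoc,
      whisker_exchange_assoc, whiskerLeft_cofreeLact_ev, associator_inv_naturality_middle_assoc,
      ← reassoc_of% h, associator_inv_naturality_left_assoc]
    simp)

/-- The functor `Y ↦ [C(c, -), Y]`. -/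
def cofree (c : C) : V ⥤ VPresheaf V C where
  obj Y := ofLeftModule (cofreeModule c Y)
  map {Y Z} f := homToOfLeftModule (X := ofLeftModule (cofreeModule c Y))
    (fun c' => (ihom (c ⟶[V] c')).map f)
    (fun c' c'' => by
      rw [ofLeftModule_lact]
      exact cofreeLact_naturality c f c' c'')
  map_id A := hom_ext fun c' => (ihom _).map_id _
  map_comp f g := hom_ext fun c' => (ihom _).map_comp _ _

lemma cofree_obj_lact (c : C) (A : V) (c' c'' : C) :
    ((cofree c).obj A).lact c' c'' = cofreeLact c A c' c'' :=
  ofLeftModule_lact _ _ _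

/-- The morphism `X ⟶ [C(c, -), Y]` attached to `X c ⟶ Y`. -/
def cofreeLift {c : C} {Y : V} {X : VPresheaf V C} (g : X.val c ⟶ Y) : X ⟶ (cofree c).obj Y :=
  homToOfLeftModule (fun c' => MonoidalClosed.curry (X.lact c' c ≫ g)) (fun c' c'' =>
    MonoidalClosed.uncurry_injective (by
      dsimp only [cofreeModule]
      rw [MonoidalClosed.uncurry_natural_left, MonoidalClosed.uncurry_curry,
        MonoidalClosed.uncurry_natural_left, MonoidalClosed.uncurry_eq, whiskerLeft_cofreeLact_ev,
        associator_inv_naturality_right_assoc, whisker_exchange_assoc,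
        ← MonoidalClosed.uncurry_eq, MonoidalClosed.uncurry_curry, ← Category.assoc (_ ▷ _),
        lact_comp]
      simp))

@[simp]
lemma cofreeLift_app {c : C} {Y : V} {X : VPresheaf V C} (g : X.val c ⟶ Y) (c' : C) :
    (cofreeLift g).app c' = MonoidalClosed.curry (X.lact c' c ≫ g) := rfl

/-- The canonical morphism `[C(c, c), Y] ⟶ Y`. -/
def cofreeCounit (c : C) (Y : V) : ((cofree c).obj Y).val c ⟶ Y :=
  (λ_ _).inv ≫ eId V c ▷ (ihom (c ⟶[V] c)).obj Y ≫ (ihom.ev (c ⟶[V] c)).app Y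

lemma cofreeLift_cofreeCounit {c : C} {Y : V} {X : VPresheaf V C} (g : X.val c ⟶ Y) :
    (cofreeLift g).app c ≫ cofreeCounit c Y = g := by
  have : MonoidalClosed.curry (X.lact c c ≫ g) ≫ (λ_ _).inv ≫
      eId V c ▷ (ihom (c ⟶[V] c)).obj Y ≫ (ihom.ev (c ⟶[V] c)).app Y = g := by
    rw [leftUnitor_inv_naturality_assoc, whisker_exchange_assoc, ← MonoidalClosed.uncurry_eq,
      MonoidalClosed.uncurry_curry, ← Category.assoc (_ ▷ _), lact_id, Iso.inv_hom_id_assoc]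
  exact this

/-- The dual Yoneda argument: acting and then evaluating at the identity of `c` recovers evaluation
at an arbitrary element of `C(c, c')`, so a morphism into the cofree presheaf is determined by its
composite with the counit. -/
lemma lact_cofreeCounit (c c' : C) (Y : V) :
    ((cofree c).obj Y).lact c' c ≫ cofreeCounit c Y = (ihom.ev (c ⟶[V] c')).app Y := by
  rw [cofree_obj_lact]
  have : cofreeLact c Y c' c ≫ (λ_ _).inv ≫
      eId V c ▷ (ihom (c ⟶[V] c)).obj Y ≫ (ihom.ev (c ⟶[V] c)).app Y =
      (ihom.ev (c ⟶[V] c')).app Y := by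
    rw [leftUnitor_inv_naturality_assoc, whisker_exchange_assoc, whiskerLeft_cofreeLact_ev,
      associator_inv_naturality_left_assoc, ← cancel_epi (λ_ _).hom, Iso.hom_inv_id_assoc]
    rw [← eId_whiskerRight_eComp]
    simp
  exact this

lemma cofreeLift_cofreeCounit' {c : C} {Y : V} {X : VPresheaf V C} (f : X ⟶ (cofree c).obj Y) :
    cofreeLift (f.app c ≫ cofreeCounit c Y) = f := hom_ext fun c' => by
  rw [cofreeLift_app, ← Category.assoc, f.lact_naturality, Category.assoc, lact_cofreeCounit]
  exact (congrArg _ (MonoidalClosed.uncurry_eq (f.app c')).symm).trans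
    (MonoidalClosed.curry_uncurry _)

/-- `Y ↦ [C(c, -), Y]` is right adjoint to evaluation at `c`. -/
def cofreeAdjunction (c : C) : evaluation V c ⊣ cofree (V := V) c :=
  Adjunction.mkOfHomEquiv
    { homEquiv := fun X Y =>
        { toFun := fun g => cofreeLift g
          invFun := fun f => f.app c ≫ cofreeCounit c Y
          left_inv := fun g => cofreeLift_cofreeCounit g
          right_inv := fun f => cofreeLift_cofreeCounit' f }
      homEquiv_naturality_left_symm := fun f g => Category.assoc _ _ _
      homEquiv_naturality_right := fun f g => hom_ext fun c' => by
        exact (congrArg _ (Category.assoc _ _ _).symm).trans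
          (MonoidalClosed.curry_natural_right _ _) }

lemma cofreeAdjunction_homEquiv_apply (c : C) {X : VPresheaf V C} {Y : V} (g : X.val c ⟶ Y) :
    (cofreeAdjunction c).homEquiv X Y g = cofreeLift g := by
  rw [cofreeAdjunction, Adjunction.mkOfHomEquiv_homEquiv]
  rfl

end Cofree

end VPresheaf
end FreeAndCofree

/-! ### Presentation by free presheaves and existence of the left Kan extension -/

section LeftKanExtension

variable {V : Type u} [Category.{v} V] [MonoidalCategory V] [SymmetricCategory V]
  [MonoidalClosed V] {C D : Type v} [EnrichedCategory V C] [EnrichedCategory V D]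

namespace VPresheaf

lemma freeAdjunction_homEquiv_symm_comp (c : C) {A : V} {X Y : VPresheaf V C} (g : A ⟶ X.val c)
    (f : X ⟶ Y) : freeDesc g ≫ f = freeDesc (g ≫ f.app c) := by
  rw [← freeAdjunction_homEquiv_symm_apply, ← freeAdjunction_homEquiv_symm_apply]
  exact ((freeAdjunction c).homEquiv_naturality_right_symm g f).symm

lemma free_map_freeDesc (c : C) {A B : V} {X : VPresheaf V C} (f : A ⟶ B) (g : B ⟶ X.val c) :
    (free c).map f ≫ freeDesc g = freeDesc (f ≫ g) := by
  rw [← freeAdjunction_homEquiv_symm_apply, ← freeAdjunction_homEquiv_symm_apply]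
  exact ((freeAdjunction c).homEquiv_naturality_left_symm f g).symm

lemma freeDesc_injective {c : C} {A : V} {X : VPresheaf V C} {g g' : A ⟶ X.val c}
    (h : freeDesc g = freeDesc g') : g = g' := by
  rw [← freeUnit_freeDesc g, h, freeUnit_freeDesc]

/-- The first map in the presentation of `X` by free presheaves. -/
def presentationFst (X : VPresheaf V C) (c c' : C) :
    (free c').obj ((c' ⟶[V] c) ⊗ X.val c) ⟶ (free c').obj (X.val c') :=
  (free c').map (X.lact c c')

/-- The second map in the presentation of `X` by free presheaves. -/
def presentationSnd (X : VPresheaf V C) (c c' : C) :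
    (free c').obj ((c' ⟶[V] c) ⊗ X.val c) ⟶ (free c).obj (X.val c) :=
  freeDesc ((c' ⟶[V] c) ◁ freeUnit c (X.val c) ≫ ((free c).obj (X.val c)).lact c c')

lemma presentationFst_comp (X : VPresheaf V C) (c c' : C) {Z : VPresheaf V C}
    (h : (free c').obj (X.val c') ⟶ Z) :
    presentationFst X c c' ≫ h = freeDesc (X.lact c c' ≫ freeUnit c' (X.val c') ≫ h.app c') := by
  rw [← free_map_freeDesc, freeDesc_freeUnit]
  rfl

lemma presentationSnd_comp (X : VPresheaf V C) (c c' : C) {Z : VPresheaf V C}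
    (h : (free c).obj (X.val c) ⟶ Z) :
    presentationSnd X c c' ≫ h =
      freeDesc ((c' ⟶[V] c) ◁ (freeUnit c (X.val c) ≫ h.app c) ≫ Z.lact c c') := by
  rw [presentationSnd, freeAdjunction_homEquiv_symm_comp, Category.assoc, Hom.lact_naturality,
    whiskerLeft_comp_assoc]

/-- The diagram of free presheaves whose colimit is `X`. -/
def presentation (X : VPresheaf V C) :
    MultispanIndex ({ L := C × C, R := C, fst := Prod.snd, snd := Prod.fst } : MultispanShape)
      (VPresheaf V C) where
  left p := (free p.2).obj ((p.2 ⟶[V] p.1) ⊗ X.val p.1)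
  right c := (free c).obj (X.val c)
  fst p := presentationFst X p.1 p.2
  snd p := presentationSnd X p.1 p.2

lemma presentation_condition (X : VPresheaf V C) (c c' : C) :
    presentationFst X c c' ≫ freeDesc (𝟙 (X.val c')) =
      presentationSnd X c c' ≫ freeDesc (𝟙 (X.val c)) := by
  rw [presentationFst_comp, presentationSnd_comp, freeUnit_freeDesc, freeUnit_freeDesc]
  simp

/-- `X` as a multicofork of free presheaves. -/
def presentationCofork (X : VPresheaf V C) : Multicofork X.presentation :=
  Multicofork.ofπ _ X (fun c => freeDesc (𝟙 (X.val c))) (fun p => X.presentation_condition p.1 p.2)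

/-- A family of morphisms from free presheaves, compatible with the presentation of `X`,
induces a morphism from `X`. -/
def presentationDesc {X Z : VPresheaf V C} (h : ∀ c, (free c).obj (X.val c) ⟶ Z)
    (w : ∀ c c', presentationFst X c c' ≫ h c' = presentationSnd X c c' ≫ h c) : X ⟶ Z :=
  homMk (fun c => freeUnit c (X.val c) ≫ (h c).app c) fun c c' => freeDesc_injective (by
    rw [← presentationFst_comp, ← presentationSnd_comp, w])

lemma freeDesc_presentationDesc {X Z : VPresheaf V C} (h : ∀ c, (free c).obj (X.val c) ⟶ Z) (w)
    (c : C) : freeDesc (𝟙 (X.val c)) ≫ presentationDesc h w = h c := by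
  rw [freeAdjunction_homEquiv_symm_comp, Category.id_comp]
  exact freeDesc_freeUnit _

lemma presentation_hom_ext {X Z : VPresheaf V C} {f g : X ⟶ Z}
    (h : ∀ c, freeDesc (𝟙 (X.val c)) ≫ f = freeDesc (𝟙 (X.val c)) ≫ g) : f = g :=
  hom_ext fun c => by
    simpa [freeAdjunction_homEquiv_symm_comp] using freeDesc_injective
      (((freeAdjunction_homEquiv_symm_comp _ _ _).symm.trans (h c)).trans
        (freeAdjunction_homEquiv_symm_comp _ _ _))

/-- Every presheaf is a colimit of free presheaves. -/
def isColimitPresentationCofork (X : VPresheaf V C) :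
    IsColimit X.presentationCofork :=
  Multicofork.IsColimit.mk _
    (fun E => presentationDesc (X := X) (Z := E.pt) E.π fun c c' => E.condition (c, c'))
    (fun E c => freeDesc_presentationDesc (X := X) (Z := E.pt) E.π _ c)
    (fun E _ hm => presentation_hom_ext (X := X) (Z := E.pt) fun c =>
      (hm c).trans (freeDesc_presentationDesc (X := X) (Z := E.pt) E.π _ c).symm)

variable (F : EnrichedFunctor V D C)

/-- The restriction functor has a partial left adjoint which sends free presheaves to
free presheaves. -/
def corepresentableByFree (d : D) (A : V) :
    (restriction F ⋙ coyoneda.obj (op ((free d).obj A))).CorepresentableBy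
      ((free (F.obj d)).obj A) where
  homEquiv {Z} :=
    { toFun := fun f => freeDesc (X := (restriction F).obj Z) (freeUnit (F.obj d) A ≫ f.app (F.obj d))
      invFun := fun g => freeDesc (freeUnit d A ≫ Hom.app (Y := (restriction F).obj Z) g d)
      left_inv := fun f => (congrArg (freeDesc (X := Z)) (freeUnit_freeDesc (X := (restriction F).obj Z)
        (freeUnit (F.obj d) A ≫ f.app (F.obj d)))).trans (freeDesc_freeUnit f)
      right_inv := fun g => (congrArg (freeDesc (X := (restriction F).obj Z))
        (freeUnit_freeDesc (X := Z) (freeUnit d A ≫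
          Hom.app (Y := (restriction F).obj Z) g d))).trans (freeDesc_freeUnit g) }
  homEquiv_comp {Z Z'} g _ :=
    (congrArg (freeDesc (X := (restriction F).obj Z')) (Category.assoc _ _ _).symm).trans
      (freeAdjunction_homEquiv_symm_comp d (X := (restriction F).obj Z) _
        ((restriction F).map g)).symm

/-- The objects at which a partial left adjoint is defined are closed under the colimits that exist
in the target. They contain the free presheaves, and `presentationCofork` reaches all others. -/
instance [HasColimits V] : (restriction F).IsRightAdjoint := by
  refine Functor.isRightAdjoint_of_leftAdjointObjIsDefined_eq_top (top_unique fun X _ => ?_)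
  refine Functor.leftAdjointObjIsDefined_of_isColimit X.isColimitPresentationCofork ?_
  rintro (p | d)
  · exact (corepresentableByFree F p.2 _).isCorepresentable
  · exact (corepresentableByFree F d _).isCorepresentable

end VPresheaf
end LeftKanExtension

/-! ### Weak equivalences are the maps inverted in the homotopy category -/

section Saturation

variable {M : Type*} [Category* M] [ModelCategory M]

lemma isIso_Q_map {X Y : M} (f : X ⟶ Y) [WeakEquivalence f] :
    IsIso ((weakEquivalences M).Q.map f) :=
  Localization.inverts (weakEquivalences M).Q (weakEquivalences M) f (mem_weakEquivalences f)

lemma exists_cofibrant_resolution (X : M) :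
    ∃ (X' : M) (p : X' ⟶ X), IsCofibrant X' ∧ Fibration p ∧ WeakEquivalence p := by
  let h := MorphismProperty.factorizationData (cofibrations M) (trivialFibrations M) (initial.to X)
  refine ⟨h.Z, h.p, ?_, inferInstance, inferInstance⟩
  rw [isCofibrant_iff, Subsingleton.elim (initial.to h.Z) h.i]
  infer_instance

lemma exists_fibrant_resolution (X : M) :
    ∃ (X' : M) (i : X ⟶ X'), IsFibrant X' ∧ Cofibration i ∧ WeakEquivalence i := by
  let h := MorphismProperty.factorizationData (trivialCofibrations M) (fibrations M)
    (terminal.from X)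
  refine ⟨h.Z, h.i, ?_, inferInstance, inferInstance⟩
  rw [isFibrant_iff, Subsingleton.elim (terminal.from h.Z) h.p]
  infer_instance

lemma weakEquivalence_of_retract {A B X Y : M} {f : A ⟶ B} {g : X ⟶ Y} (h : RetractArrow f g)
    [WeakEquivalence g] : WeakEquivalence f := by
  rw [weakEquivalence_iff]
  exact MorphismProperty.of_retract h (mem_weakEquivalences g)

/-- On a bifibrant object, equality in the homotopy category is realised by an actual homotopy, and
being a weak equivalence is invariant under homotopy. -/
lemma weakEquivalence_of_map_eq_id {X : M} [IsCofibrant X] [IsFibrant X] (f : X ⟶ X)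
    (hf : (weakEquivalences M).Q.map f = 𝟙 _) : WeakEquivalence f := by
  rw [← CategoryTheory.Functor.map_id, ← RightHomotopyRel.iff_map_eq] at hf
  obtain ⟨P, ⟨h⟩⟩ := hf
  rw [h.weakEquivalence_iff]
  infer_instance

lemma weakEquivalence_of_isIso_of_fibration {X Y : M} [IsCofibrant X] [IsFibrant X]
    [IsCofibrant Y] [IsFibrant Y] (p : X ⟶ Y) [Fibration p]
    [IsIso ((weakEquivalences M).Q.map p)] : WeakEquivalence p := by
  let L := (weakEquivalences M).Q
  obtain ⟨q, hq⟩ := map_surjective_of_isLocalization L Y X (inv (L.map p))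
  have h₁ : LeftHomotopyRel (q ≫ p) (𝟙 Y) := by
    rw [LeftHomotopyRel.iff_map_eq L, Functor.map_comp, hq, IsIso.inv_hom_id,
      CategoryTheory.Functor.map_id]
  obtain ⟨P, _, ⟨h⟩⟩ := h₁.exists_good_cylinder
  -- The homotopy from `q ≫ p` to the identity lifts along the fibration `p`. Its other end is a
  -- strict section `s` in the homotopy class of `q`.
  obtain ⟨s, h', hs⟩ := h.covering_homotopy p q
  have hsp : s ≫ p = 𝟙 Y := by
    rw [← h'.h₁, Category.assoc, hs, h.h₁]
  have hs' : L.map s = inv (L.map p) := by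
    rw [← hq]
    exact ((LeftHomotopyRel.iff_map_eq L Y X).1 h'.leftHomotopyRel).symm
  have : WeakEquivalence (p ≫ s) := weakEquivalence_of_map_eq_id _ (by
    change L.map _ = _
    rw [Functor.map_comp, hs', IsIso.hom_inv_id])
  -- Since `s ≫ p = 𝟙`, the map `p` is a retract of `p ≫ s`.
  exact weakEquivalence_of_retract (g := p ≫ s)
    { i := Arrow.homMk (𝟙 X) s (by simp)
      r := Arrow.homMk (𝟙 X) p (by simp [hsp])
      retract := by ext <;> simp [hsp] }

lemma weakEquivalence_of_isIso_of_bifibrant {X Y : M} [IsCofibrant X] [IsFibrant X]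
    [IsCofibrant Y] [IsFibrant Y] (f : X ⟶ Y)
    [IsIso ((weakEquivalences M).Q.map f)] : WeakEquivalence f := by
  let h := MorphismProperty.factorizationData (trivialCofibrations M) (fibrations M) f
  have : IsCofibrant h.Z := isCofibrant_of_cofibration h.i
  have : IsFibrant h.Z := isFibrant_of_fibration h.p
  have := isIso_Q_map h.i
  have : IsIso ((weakEquivalences M).Q.map h.p) := by
    have e : (weakEquivalences M).Q.map h.i ≫ (weakEquivalences M).Q.map h.p =
        (weakEquivalences M).Q.map f := by rw [← Functor.map_comp, h.fac]
    exact IsIso.of_isIso_fac_left e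
  have := weakEquivalence_of_isIso_of_fibration h.p
  rw [← h.fac]
  infer_instance

/-- A morphism in a model category is a weak equivalence if it becomes invertible in the
homotopy category. -/
lemma weakEquivalence_of_isIso_Q_map {X Y : M} (f : X ⟶ Y)
    [IsIso ((weakEquivalences M).Q.map f)] : WeakEquivalence f := by
  let L := (weakEquivalences M).Q
  obtain ⟨X', p, _, _, _⟩ := exists_cofibrant_resolution X
  obtain ⟨Y', q, _, _, _⟩ := exists_cofibrant_resolution Y
  obtain ⟨X'', i, _, _, _⟩ := exists_fibrant_resolution X'
  obtain ⟨Y'', j, _, _, _⟩ := exists_fibrant_resolution Y'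
  have : IsCofibrant X'' := isCofibrant_of_cofibration i
  have : IsCofibrant Y'' := isCofibrant_of_cofibration j
  -- The two lifts replace `f` first by a map of cofibrant objects and then by a map of bifibrant
  -- ones.
  have sq : CommSq (initial.to Y') (initial.to X') q (p ≫ f) := ⟨Subsingleton.elim _ _⟩
  have sq' : CommSq (sq.lift ≫ j) i (terminal.from Y'') (terminal.from X'') :=
    ⟨Subsingleton.elim _ _⟩
  have := isIso_Q_map p
  have := isIso_Q_map q
  have := isIso_Q_map i
  have := isIso_Q_map j
  have : IsIso (L.map sq.lift) := by
    have e : L.map sq.lift ≫ L.map q = L.map p ≫ L.map f := by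
      rw [← Functor.map_comp, sq.fac_right, Functor.map_comp]
    have : IsIso (L.map sq.lift ≫ L.map q) := by rw [e]; infer_instance
    exact IsIso.of_isIso_comp_right _ (L.map q)
  have : IsIso (L.map sq'.lift) := by
    have e : L.map i ≫ L.map sq'.lift = L.map sq.lift ≫ L.map j := by
      rw [← Functor.map_comp, sq'.fac_left, Functor.map_comp]
    have : IsIso (L.map i ≫ L.map sq'.lift) := by rw [e]; infer_instance
    exact IsIso.of_isIso_comp_left (L.map i) _
  have := weakEquivalence_of_isIso_of_bifibrant sq'.lift
  have : WeakEquivalence (sq.lift ≫ j) := by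
    rw [← sq'.fac_left]
    infer_instance
  have := weakEquivalence_of_postcomp sq.lift j
  have : WeakEquivalence (p ≫ f) := by
    rw [← sq.fac_right]
    infer_instance
  exact weakEquivalence_of_precomp p f

/-- The two out of six property, for the last morphism. -/
lemma weakEquivalence_of_two_out_of_six {X Y Z T : M} (f : X ⟶ Y) (g : Y ⟶ Z) (h : Z ⟶ T)
    [WeakEquivalence (f ≫ g)] [WeakEquivalence (g ≫ h)] : WeakEquivalence h := by
  let L := (weakEquivalences M).Q
  have h₁ : IsIso (L.map f ≫ L.map g) := by
    rw [← Functor.map_comp]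
    exact isIso_Q_map _
  have h₂ : IsIso (L.map g ≫ L.map h) := by
    rw [← Functor.map_comp]
    exact isIso_Q_map _
  -- The first composite gives `L.map g` a right-hand inverse, and the second makes it a
  -- monomorphism.
  have : IsIso (L.map g) := by
    have : IsSplitEpi (L.map g) :=
      ⟨⟨⟨inv (L.map f ≫ L.map g) ≫ L.map f, by rw [Category.assoc, IsIso.inv_hom_id]⟩⟩⟩
    have : Mono (L.map g) := mono_of_mono (L.map g) (L.map h)
    exact isIso_of_mono_of_isSplitEpi _
  have : IsIso ((weakEquivalences M).Q.map h) := IsIso.of_isIso_comp_left (L.map g) _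
  exact weakEquivalence_of_isIso_Q_map h

/-- A Yoneda argument in the homotopy category. Fibrant targets suffice, since every object has a
fibrant replacement, and genuine maps suffice, since maps from cofibrant to fibrant objects
represent all homotopy classes. -/
lemma weakEquivalence_of_precomp_bijective {A B : M} [IsCofibrant A] [IsCofibrant B] (u : A ⟶ B)
    (hs : ∀ (Y : M) (_ : IsFibrant Y) (a : A ⟶ Y), ∃ b : B ⟶ Y,
      (weakEquivalences M).Q.map (u ≫ b) = (weakEquivalences M).Q.map a)
    (hi : ∀ (Y : M) (_ : IsFibrant Y) (b₀ b₁ : B ⟶ Y),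
      (weakEquivalences M).Q.map (u ≫ b₀) = (weakEquivalences M).Q.map (u ≫ b₁) →
      (weakEquivalences M).Q.map b₀ = (weakEquivalences M).Q.map b₁) :
    WeakEquivalence u := by
  let L := (weakEquivalences M).Q
  obtain ⟨A', j, _, _, _⟩ := exists_fibrant_resolution A
  obtain ⟨B', k, _, _, _⟩ := exists_fibrant_resolution B
  have := isIso_Q_map j
  have := isIso_Q_map k
  -- Surjectivity at the fibrant replacement of `A` yields one side of the inverse. Injectivity at
  -- that of `B` will yield the other.
  obtain ⟨b, hb⟩ := hs A' inferInstance j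
  have h₁ : L.map u ≫ L.map b ≫ inv (L.map j) = 𝟙 _ := by
    rw [← Category.assoc, ← Functor.map_comp, hb, IsIso.hom_inv_id]
  obtain ⟨b', hb'⟩ := map_surjective_of_isLocalization L B B'
    ((L.map b ≫ inv (L.map j)) ≫ L.map u ≫ L.map k)
  have h₂ : (L.map b ≫ inv (L.map j)) ≫ L.map u = 𝟙 _ := by
    rw [← cancel_mono (L.map k), Category.assoc, ← hb', Category.id_comp]
    refine hi B' inferInstance _ _ ?_
    change L.map _ = L.map _
    rw [Functor.map_comp, Functor.map_comp, hb', ← Category.assoc, h₁, Category.id_comp]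
  have : IsIso ((weakEquivalences M).Q.map u) := ⟨_, h₁, h₂⟩
  exact weakEquivalence_of_isIso_Q_map u

lemma weakEquivalence_of_postcomp_bijective {A B : M} [IsFibrant A] [IsFibrant B] (w : A ⟶ B)
    (hs : ∀ (X : M) (_ : IsCofibrant X) (b : X ⟶ B), ∃ a : X ⟶ A,
      (weakEquivalences M).Q.map (a ≫ w) = (weakEquivalences M).Q.map b)
    (hi : ∀ (X : M) (_ : IsCofibrant X) (a₀ a₁ : X ⟶ A),
      (weakEquivalences M).Q.map (a₀ ≫ w) = (weakEquivalences M).Q.map (a₁ ≫ w) →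
      (weakEquivalences M).Q.map a₀ = (weakEquivalences M).Q.map a₁) :
    WeakEquivalence w := by
  let L := (weakEquivalences M).Q
  obtain ⟨B', j, _, _, _⟩ := exists_cofibrant_resolution B
  obtain ⟨A', k, _, _, _⟩ := exists_cofibrant_resolution A
  have := isIso_Q_map j
  have := isIso_Q_map k
  obtain ⟨a, ha⟩ := hs B' inferInstance j
  have h₁ : (inv (L.map j) ≫ L.map a) ≫ L.map w = 𝟙 _ := by
    rw [Category.assoc, ← Functor.map_comp, ha, IsIso.inv_hom_id]
  obtain ⟨a', ha'⟩ := map_surjective_of_isLocalization L A' A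
    (L.map k ≫ L.map w ≫ inv (L.map j) ≫ L.map a)
  have h₂ : L.map w ≫ inv (L.map j) ≫ L.map a = 𝟙 _ := by
    rw [← cancel_epi (L.map k), ← ha', Category.comp_id]
    refine hi A' inferInstance _ _ ?_
    change L.map _ = L.map _
    rw [Functor.map_comp, Functor.map_comp, ha', Category.assoc, Category.assoc, h₁,
      Category.comp_id]
  have : IsIso ((weakEquivalences M).Q.map w) := ⟨_, h₂, h₁⟩
  exact weakEquivalence_of_isIso_Q_map w

end Saturation

/-! ### Quillen adjunctions on homotopy classes and conjugate transformations -/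

section QuillenAdjunctions

variable {A B : Type*} [Category* A] [Category* B] [ModelCategory A] [ModelCategory B]

/-- Ken Brown's lemma. -/
lemma weakEquivalence_map_of_isCofibrant (G : A ⥤ B)
    (hG : ∀ ⦃X Y : A⦄ (f : X ⟶ Y), Cofibration f → WeakEquivalence f → WeakEquivalence (G.map f))
    {X Y : A} [IsCofibrant X] [IsCofibrant Y] (f : X ⟶ Y) [WeakEquivalence f] :
    WeakEquivalence (G.map f) := by
  obtain ⟨h⟩ : Nonempty (CofibrantBrownFactorization f) := inferInstance
  have := hG h.i inferInstance inferInstance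
  have := hG h.s inferInstance inferInstance
  have fac : G.map h.s ≫ G.map h.p = 𝟙 _ := by rw [← G.map_comp, h.s_p, G.map_id]
  have := weakEquivalence_of_precomp_of_fac fac
  rw [← h.fac, G.map_comp]
  infer_instance

namespace IsQuillenAdjunction

variable {G : A ⥤ B} {R : B ⥤ A} {adj : G ⊣ R} (h : IsQuillenAdjunction adj)

include h

lemma fibration_map {X Y : B} (p : X ⟶ Y) [Fibration p] : Fibration (R.map p) := by
  rw [fibration_iff, ← trivialCofibrations_rlp]
  intro _ _ i hi
  rw [mem_trivialCofibrations_iff] at hi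
  have := hi.1
  have := hi.2
  obtain ⟨_, _⟩ := h.trivialCofibration i inferInstance inferInstance
  rw [← adj.hasLiftingProperty_iff]
  infer_instance

lemma weakEquivalence_map_of_fibration {X Y : B} (p : X ⟶ Y) [Fibration p] [WeakEquivalence p] :
    WeakEquivalence (R.map p) := by
  have : trivialFibrations A (R.map p) := by
    rw [← cofibrations_rlp]
    intro _ _ i hi
    rw [← cofibration_iff] at hi
    have := h.cofibration i inferInstance
    rw [← adj.hasLiftingProperty_iff]
    infer_instance
  exact (mem_trivialFibrations_iff _).1 this |>.2

lemma isCofibrant_obj (X : A) [IsCofibrant X] : IsCofibrant (G.obj X) := by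
  have : G.IsLeftAdjoint := adj.isLeftAdjoint
  rw [isCofibrant_iff_of_isInitial (G.map (initial.to X)) (initialIsInitial.isInitialObj G _)]
  exact h.cofibration _ inferInstance

lemma isFibrant_obj (Y : B) [IsFibrant Y] : IsFibrant (R.obj Y) := by
  have : R.IsRightAdjoint := adj.isRightAdjoint
  rw [isFibrant_iff_of_isTerminal (R.map (terminal.from Y))
    (terminalIsTerminal.isTerminalObj R _)]
  exact h.fibration_map _

/-- A Quillen adjunction induces bijections on homotopy classes. -/
lemma map_homEquiv_eq_iff {X : A} {Y : B} [IsCofibrant X] [IsFibrant Y] (f g : G.obj X ⟶ Y) :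
    (weakEquivalences A).Q.map (adj.homEquiv X Y f) =
      (weakEquivalences A).Q.map (adj.homEquiv X Y g) ↔
    (weakEquivalences B).Q.map f = (weakEquivalences B).Q.map g := by
  have := h.isCofibrant_obj X
  have := h.isFibrant_obj Y
  constructor
  · intro e
    rw [← LeftHomotopyRel.iff_map_eq] at e
    -- `G` sends the cylinder inclusion `i₀` to a trivial cofibration, so the image of `π` is
    -- inverted. Both inclusions are sections of `π`, hence become equal.
    obtain ⟨P, _, ⟨⟨H, H₀, H₁⟩⟩⟩ := e.exists_good_cylinder
    let L := G ⋙ (weakEquivalences B).Q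
    have hi := (h.trivialCofibration P.i₀ inferInstance inferInstance).2
    have hi' : IsIso (L.map P.i₀) := isIso_Q_map (G.map P.i₀)
    have hπ : L.map P.i₀ ≫ L.map P.π = 𝟙 _ := by
      rw [← L.map_comp, P.i₀_π, L.map_id]
    have hπ₁ : L.map P.i₁ ≫ L.map P.π = 𝟙 _ := by
      rw [← L.map_comp, P.i₁_π, L.map_id]
    have : IsIso (L.map P.π) := by
      rw [← IsIso.inv_eq_of_hom_inv_id hπ]
      infer_instance
    have key : L.map P.i₀ = L.map P.i₁ := by
      rw [← cancel_mono (L.map P.π), hπ, hπ₁]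
    have h₀ := congrArg (adj.homEquiv X Y).symm H₀
    have h₁ := congrArg (adj.homEquiv X Y).symm H₁
    rw [adj.homEquiv_naturality_left_symm, Equiv.symm_apply_apply] at h₀ h₁
    rw [← h₀, ← h₁, Functor.map_comp, Functor.map_comp]
    exact congrArg (· ≫ _) key
  · intro e
    rw [← RightHomotopyRel.iff_map_eq] at e
    obtain ⟨P, _, ⟨⟨H, H₀, H₁⟩⟩⟩ := e.exists_good_pathObject
    let L := R ⋙ (weakEquivalences A).Q
    have hp := h.weakEquivalence_map_of_fibration P.p₀
    have hp' : IsIso (L.map P.p₀) := isIso_Q_map (R.map P.p₀)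
    have hι : L.map P.ι ≫ L.map P.p₀ = 𝟙 _ := by
      rw [← L.map_comp, P.ι_p₀, L.map_id]
    have hι₁ : L.map P.ι ≫ L.map P.p₁ = 𝟙 _ := by
      rw [← L.map_comp, P.ι_p₁, L.map_id]
    have : IsIso (L.map P.ι) := by
      rw [← IsIso.inv_eq_of_inv_hom_id hι]
      infer_instance
    have key : L.map P.p₀ = L.map P.p₁ := by
      rw [← cancel_epi (L.map P.ι), hι, hι₁]
    rw [← H₀, ← H₁, adj.homEquiv_naturality_right, adj.homEquiv_naturality_right,
      Functor.map_comp, Functor.map_comp]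
    exact congrArg (_ ≫ ·) key

variable {G' : A ⥤ B} {R' : B ⥤ A} {adj' : G' ⊣ R'} (h' : IsQuillenAdjunction adj')

include h'

/-- If conjugate transformations of right Quillen functors are weak equivalences at fibrant objects,
then the transformation of left Quillen functors is one at cofibrant objects. -/
lemma weakEquivalence_of_conjugate (X : A) [IsCofibrant X] (v : G.obj X ⟶ G'.obj X)
    (w : ∀ Y, R'.obj Y ⟶ R.obj Y)
    (comm : ∀ (Y : B) (f : G'.obj X ⟶ Y),
      adj.homEquiv X Y (v ≫ f) = adj'.homEquiv X Y f ≫ w Y)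
    (hw : ∀ Y, IsFibrant Y → WeakEquivalence (w Y)) : WeakEquivalence v := by
  have := h.isCofibrant_obj X
  have := h'.isCofibrant_obj X
  refine weakEquivalence_of_precomp_bijective v (fun Y hY a => ?_) (fun Y hY b₀ b₁ e => ?_)
  · have := hw Y hY
    have := h'.isFibrant_obj Y
    have := isIso_Q_map (w Y)
    -- `X` is cofibrant and `R' Y` fibrant, so the class obtained by inverting `w Y` is represented
    -- by a map.
    obtain ⟨c, hc⟩ := map_surjective_of_isLocalization (weakEquivalences A).Q X (R'.obj Y)
      ((weakEquivalences A).Q.map (adj.homEquiv X Y a) ≫ inv ((weakEquivalences A).Q.map (w Y)))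
    refine ⟨(adj'.homEquiv X Y).symm c, ?_⟩
    rw [← h.map_homEquiv_eq_iff, comm, Equiv.apply_symm_apply, Functor.map_comp, hc,
      Category.assoc, IsIso.inv_hom_id, Category.comp_id]
  · have := hw Y hY
    have := isIso_Q_map (w Y)
    rw [← h.map_homEquiv_eq_iff, comm, comm, Functor.map_comp, Functor.map_comp,
      cancel_mono] at e
    rwa [← h'.map_homEquiv_eq_iff]

/-- If conjugate transformations of left Quillen functors are weak equivalences at cofibrant
objects, then the transformation of right Quillen functors is one at fibrant objects. -/
lemma weakEquivalence_of_conjugate_right (Y : B) [IsFibrant Y] (v : ∀ X, G.obj X ⟶ G'.obj X)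
    (w : R'.obj Y ⟶ R.obj Y)
    (comm : ∀ (X : A) (f : G'.obj X ⟶ Y),
      adj.homEquiv X Y (v X ≫ f) = adj'.homEquiv X Y f ≫ w)
    (hv : ∀ X, IsCofibrant X → WeakEquivalence (v X)) : WeakEquivalence w := by
  have := h.isFibrant_obj Y
  have := h'.isFibrant_obj Y
  refine weakEquivalence_of_postcomp_bijective w (fun X hX a => ?_) (fun X hX b₀ b₁ e => ?_)
  · have := hv X hX
    have := h'.isCofibrant_obj X
    have := isIso_Q_map (v X)
    obtain ⟨c, hc⟩ := map_surjective_of_isLocalization (weakEquivalences B).Q (G'.obj X) Y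
      (inv ((weakEquivalences B).Q.map (v X)) ≫
        (weakEquivalences B).Q.map ((adj.homEquiv X Y).symm a))
    refine ⟨adj'.homEquiv X Y c, ?_⟩
    obtain ⟨a, rfl⟩ := (adj.homEquiv X Y).surjective a
    rw [← comm, h.map_homEquiv_eq_iff, Functor.map_comp, hc, IsIso.hom_inv_id_assoc,
      Equiv.symm_apply_apply]
  · have := hv X hX
    have := isIso_Q_map (v X)
    obtain ⟨b₀, rfl⟩ := (adj'.homEquiv X Y).surjective b₀
    obtain ⟨b₁, rfl⟩ := (adj'.homEquiv X Y).surjective b₁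
    rw [← comm, ← comm, h.map_homEquiv_eq_iff, Functor.map_comp, Functor.map_comp,
      cancel_epi] at e
    rwa [h'.map_homEquiv_eq_iff]

end IsQuillenAdjunction

end QuillenAdjunctions

/-! ### Colimits over well-orders through unique existence -/

section WellOrderContinuity

variable {M : Type*} [Category* M]

lemma nonempty_isColimit_of_existsUnique {K : Type*} [Preorder K] {D : K ⥤ M} (c : Cocone D)
    (h : ∀ (Z : M) (z : ∀ k, D.obj k ⟶ Z),
      (∀ (i j : K) (hij : i ≤ j), D.map (homOfLE hij) ≫ z j = z i) →
        ∃! d : c.pt ⟶ Z, ∀ k, c.ι.app k ≫ d = z k) : Nonempty (IsColimit c) := by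
  have h' (s : Cocone D) := h s.pt s.ι.app (fun i j hij => s.w (homOfLE hij))
  exact ⟨{
    desc := fun s => (h' s).choose
    fac := fun s => (h' s).choose_spec.1
    uniq := fun s => (h' s).choose_spec.2 }⟩

lemma existsUnique_of_isColimit {K : Type*} [Preorder K] {D : K ⥤ M} {c : Cocone D}
    (hc : IsColimit c) {Z : M} (z : ∀ k, D.obj k ⟶ Z)
    (hz : ∀ (i j : K) (hij : i ≤ j), D.map (homOfLE hij) ≫ z j = z i) :
    ∃! d : c.pt ⟶ Z, ∀ k, c.ι.app k ≫ d = z k :=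
  ⟨hc.desc (Cocone.mk Z
      { app := z
        naturality := fun i j f => (hz i j (leOfHom f)).trans (Category.comp_id _).symm }),
    fun _ => hc.fac _ _, fun _ hd => hc.uniq (Cocone.mk Z _) _ hd⟩

variable {J : Type*} [LinearOrder J] (F : J ⥤ M)

lemma isWellOrderContinuous_of_existsUnique
    (h : ∀ (m : J), Order.IsSuccLimit m → ∀ (Z : M) (z : ∀ j, j < m → (F.obj j ⟶ Z)),
      (∀ (i j : J) (hij : i ≤ j) (hj : j < m),
        F.map (homOfLE hij) ≫ z j hj = z i (hij.trans_lt hj)) →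
      ∃! d : F.obj m ⟶ Z, ∀ j hj, F.map (homOfLE (le_of_lt hj)) ≫ d = z j hj) :
    F.IsWellOrderContinuous where
  nonempty_isColimit m hm := nonempty_isColimit_of_existsUnique _ fun Z z hz => by
    obtain ⟨d, hd, hd'⟩ := h m hm Z (fun j hj => z ⟨j, hj⟩)
      (fun i j hij hj => hz ⟨i, hij.trans_lt hj⟩ ⟨j, hj⟩ hij)
    exact ⟨d, fun k => hd k.1 k.2, fun d' h' => hd' d' fun j hj => h' ⟨j, hj⟩⟩

lemma existsUnique_of_isWellOrderContinuous [F.IsWellOrderContinuous] (m : J)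
    (hm : Order.IsSuccLimit m) {Z : M} (z : ∀ j, j < m → (F.obj j ⟶ Z))
    (hz : ∀ (i j : J) (hij : i ≤ j) (hj : j < m),
      F.map (homOfLE hij) ≫ z j hj = z i (hij.trans_lt hj)) :
    ∃! d : F.obj m ⟶ Z, ∀ j hj, F.map (homOfLE (le_of_lt hj)) ≫ d = z j hj := by
  obtain ⟨d, hd, hd'⟩ := existsUnique_of_isColimit (F.isColimitOfIsWellOrderContinuous m hm)
    (fun k => z k.1 k.2) (fun i j hij => hz i.1 j.1 hij j.2)
  exact ⟨d, fun j hj => hd ⟨j, hj⟩, fun d' h' => hd' d' fun k => h' k.1 k.2⟩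

end WellOrderContinuity

/-! ### Transfinite compositions are stable under cobase change -/

section CobaseChange

variable {M : Type*} [Category* M] {J : Type*} [LinearOrder J] [OrderBot J]

/-- The first map of the span defining the cobase change of a functor. -/
def cobaseChangeLeg {F : J ⥤ M} {A : M} (e : A ⟶ F.obj ⊥) (j : J) : A ⟶ F.obj j :=
  e ≫ F.map (homOfLE bot_le)

lemma cobaseChangeLeg_map {F : J ⥤ M} {A : M} (e : A ⟶ F.obj ⊥) {i j : J} (f : i ⟶ j) :
    cobaseChangeLeg e i ≫ F.map f = cobaseChangeLeg e j := by
  rw [cobaseChangeLeg, Category.assoc, ← F.map_comp]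
  rfl

/-- A cobase change of a functor `F : J ⥤ M` along a map from an object over `F.obj ⊥`. -/
structure CobaseChange {F : J ⥤ M} {A A' : M} (e : A ⟶ F.obj ⊥) (a : A ⟶ A') where
  /-- the functor -/
  functor : J ⥤ M
  /-- the first inclusion -/
  inl (j : J) : F.obj j ⟶ functor.obj j
  /-- the second inclusion -/
  inr (j : J) : A' ⟶ functor.obj j
  isPushout (j : J) : IsPushout (cobaseChangeLeg e j) a (inl j) (inr j)
  inl_map {i j : J} (f : i ⟶ j) : inl i ≫ functor.map f = F.map f ≫ inl j
  inr_map {i j : J} (f : i ⟶ j) : inr i ≫ functor.map f = inr j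

lemma nonempty_cobaseChange [HasPushouts M] {F : J ⥤ M} {A A' : M} (e : A ⟶ F.obj ⊥)
    (a : A ⟶ A') : Nonempty (CobaseChange e a) := by
  have sq (j : J) : IsPushout (cobaseChangeLeg e j) a
    (pushout.inl (cobaseChangeLeg e j) a) (pushout.inr (cobaseChangeLeg e j) a) :=
      IsPushout.of_hasPushout _ _
  exact ⟨{
    functor :=
      { obj := fun j => pushout (cobaseChangeLeg e j) a
        map := fun {i j} f => (sq i).desc (F.map f ≫ pushout.inl _ _) (pushout.inr _ _) (by
          rw [← Category.assoc, cobaseChangeLeg_map, (sq j).w])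
        map_id := fun i => (sq i).hom_ext (by simp) (by simp)
        map_comp := fun {i j k} f g => (sq i).hom_ext (by simp) (by simp) }
    inl := fun j => pushout.inl _ _
    inr := fun j => pushout.inr _ _
    isPushout := sq
    inl_map := fun {i j} f => (sq i).inl_desc _ _ _
    inr_map := fun {i j} f => (sq i).inr_desc _ _ _ }⟩

namespace CobaseChange

variable {F : J ⥤ M} {A A' : M} {e : A ⟶ F.obj ⊥} {a : A ⟶ A'} (G : CobaseChange e a)

/-- Cancellation in the pasting law: the squares from `A` to stages `i` and `j` are both pushouts.
-/
lemma isPushout_map {i j : J} (f : i ⟶ j) :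
    IsPushout (F.map f) (G.inl i) (G.inl j) (G.functor.map f) := by
  refine IsPushout.of_left ?_ (G.inl_map f).symm (G.isPushout i)
  rw [cobaseChangeLeg_map, G.inr_map]
  exact G.isPushout j

/-- Pushouts commute with the colimit at a limit stage. All maps out of `A'` agree with the one at
`⊥`, which lies below any limit element. -/
instance [F.IsWellOrderContinuous] : G.functor.IsWellOrderContinuous :=
  isWellOrderContinuous_of_existsUnique _ fun m hm Z z hz => by
    have hbot : ⊥ < m := hm.bot_lt
    obtain ⟨x, hx, hx'⟩ := existsUnique_of_isWellOrderContinuous F m hm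
      (fun j hj => G.inl j ≫ z j hj) (fun i j hij hj => by
        rw [← hz i j hij hj, ← Category.assoc, ← Category.assoc, G.inl_map])
    have hy (j hj) : G.inr j ≫ z j hj = G.inr ⊥ ≫ z ⊥ hbot := by
      rw [← hz ⊥ j bot_le hj, ← Category.assoc, G.inr_map]
    have hw : cobaseChangeLeg e m ≫ x = a ≫ G.inr ⊥ ≫ z ⊥ hbot := by
      rw [← cobaseChangeLeg_map e (homOfLE hbot.le), Category.assoc, hx ⊥ hbot,
        reassoc_of% (G.isPushout ⊥).w]
    refine ⟨(G.isPushout m).desc x (G.inr ⊥ ≫ z ⊥ hbot) hw,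
      fun j hj => (G.isPushout j).hom_ext ?_ ?_,
      fun d hd => (G.isPushout m).hom_ext ?_ ?_⟩
    · rw [← Category.assoc, G.inl_map, Category.assoc, IsPushout.inl_desc, hx]
    · rw [← Category.assoc, G.inr_map, IsPushout.inr_desc, hy j hj]
    · rw [IsPushout.inl_desc]
      refine hx' _ fun j hj => ?_
      rw [← hd j hj, ← Category.assoc, ← Category.assoc, G.inl_map]
    · rw [IsPushout.inr_desc, ← hd ⊥ hbot, ← Category.assoc, G.inr_map]

lemma nonempty_isColimit {c : Cocone F} (hc : IsColimit c) {c' : Cocone G.functor}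
    {b : c.pt ⟶ c'.pt} {f' : A' ⟶ c'.pt} (sq : IsPushout (e ≫ c.ι.app ⊥) a b f')
    (hl : ∀ j, G.inl j ≫ c'.ι.app j = c.ι.app j ≫ b)
    (hr : ∀ j, G.inr j ≫ c'.ι.app j = f') : Nonempty (IsColimit c') :=
  nonempty_isColimit_of_existsUnique _ fun Z z hz => by
    obtain ⟨x, hx, hx'⟩ := existsUnique_of_isColimit hc
      (fun j => G.inl j ≫ z j) (fun i j hij => by
        rw [← hz i j hij, ← Category.assoc, ← Category.assoc, G.inl_map])
    have hy (j) : G.inr j ≫ z j = G.inr ⊥ ≫ z ⊥ := by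
      rw [← hz ⊥ j bot_le, ← Category.assoc, G.inr_map]
    have hw : (e ≫ c.ι.app ⊥) ≫ x = a ≫ G.inr ⊥ ≫ z ⊥ := by
      rw [← reassoc_of% (G.isPushout ⊥).w, Category.assoc, hx, cobaseChangeLeg]
      simp
    refine ⟨sq.desc x (G.inr ⊥ ≫ z ⊥) hw,
      fun j => (G.isPushout j).hom_ext ?_ ?_,
      fun d hd => sq.hom_ext ?_ ?_⟩
    · rw [reassoc_of% hl j, IsPushout.inl_desc, hx]
    · rw [reassoc_of% hr j, IsPushout.inr_desc, hy j]
    · rw [IsPushout.inl_desc]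
      refine hx' _ fun j => ?_
      rw [← hd j, reassoc_of% hl j]
    · rw [IsPushout.inr_desc, ← hd ⊥, reassoc_of% hr ⊥]

end CobaseChange

/-- Push out every stage along `a`: each successor map becomes a cobase change of the original one,
and continuity and the final colimit survive since colimits commute with pushouts. -/
lemma transfiniteCompositionsOfShape_cobaseChange [HasPushouts M] [SuccOrder J] [WellFoundedLT J]
    (W : MorphismProperty M) [W.IsStableUnderCobaseChange] {A B A' B' : M} {f : A ⟶ B}
    {a : A ⟶ A'} {b : B ⟶ B'} {f' : A' ⟶ B'} (sq : IsPushout f a b f')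
    (hf : W.transfiniteCompositionsOfShape J f) : W.transfiniteCompositionsOfShape J f' := by
  obtain ⟨h⟩ := hf
  obtain ⟨G⟩ := nonempty_cobaseChange h.isoBot.inv a
  have hw (j : J) : cobaseChangeLeg h.isoBot.inv j ≫ h.incl.app j ≫ b = a ≫ f' := by
    have e : cobaseChangeLeg h.isoBot.inv j ≫ h.incl.app j = f := by
      rw [cobaseChangeLeg, Category.assoc, h.incl.naturality]
      simp
    rw [← sq.w, reassoc_of% e]
  let ι : G.functor ⟶ (Functor.const J).obj B' :=
    { app := fun j => (G.isPushout j).desc (h.incl.app j ≫ b) f' (hw j)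
      naturality := fun i j f => by
        refine (G.isPushout i).hom_ext ?_ ?_
        · rw [← Category.assoc, G.inl_map, Category.assoc, IsPushout.inl_desc, ← Category.assoc,
            h.incl.naturality]
          simp
        · rw [← Category.assoc, G.inr_map, IsPushout.inr_desc]
          simp }
  have sq' : IsPushout (h.isoBot.inv ≫ h.incl.app ⊥) a b f' := by rwa [h.fac]
  have : IsIso (G.inr ⊥) := by
    have : IsIso (cobaseChangeLeg h.isoBot.inv ⊥) := by
      have e : cobaseChangeLeg h.isoBot.inv ⊥ = h.isoBot.inv := by simp [cobaseChangeLeg]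
      rw [e]
      infer_instance
    exact (G.isPushout ⊥).isIso_inr_of_isIso
  exact ⟨{
    F := G.functor
    isoBot := (asIso (G.inr ⊥)).symm
    incl := ι
    isColimit := (G.nonempty_isColimit h.isColimit (c' := Cocone.mk B' ι) sq'
      (fun j => (G.isPushout j).inl_desc _ _ _)
      (fun j => (G.isPushout j).inr_desc _ _ _)).some
    fac := (G.isPushout ⊥).inr_desc _ _ _
    map_mem := fun j hj => MorphismProperty.of_isPushout
      (G.isPushout_map (homOfLE (Order.le_succ j))).flip (h.map_mem j hj) }⟩

end CobaseChange

lemma relativeCells_of_isPushout {M : Type u} [Category.{v} M] [HasPushouts M]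
    {I : MorphismProperty M} {A B A' B' : M} {f : A ⟶ B}
    {a : A ⟶ A'} {b : B ⟶ B'} {f' : A' ⟶ B'} (sq : IsPushout f a b f')
    (hf : relativeCells I f) : relativeCells I f' := by
  rw [relativeCells, MorphismProperty.transfiniteCompositions_iff] at hf ⊢
  obtain ⟨J, _, _, _, _, hf⟩ := hf
  exact ⟨J, inferInstance, inferInstance, inferInstance, inferInstance,
    transfiniteCompositionsOfShape_cobaseChange _ sq hf⟩

/-! ### Gluing the factorizations of all successor maps -/

section Gluing

variable {M : Type u} [Category.{v} M] {J : Type v} [LinearOrder J] [SuccOrder J]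

/-- For a functor `X : J ⥤ M` and maps `t s : X (s + 1) ⟶ E s`, an object obtained from `X j` by
gluing all `E s` with `s < j` along `t s`. -/
structure GluedObject {X : J ⥤ M} {E : J → M} (t : ∀ s, X.obj (Order.succ s) ⟶ E s) (j : J) where
  /-- the object -/
  obj : M
  /-- the inclusion of the base -/
  base : X.obj j ⟶ obj
  /-- the inclusions of the glued objects -/
  glue (s : J) (hs : s < j) : E s ⟶ obj
  w (s : J) (hs : s < j) : t s ≫ glue s hs = X.map (homOfLE (Order.succ_le_of_lt hs)) ≫ base
  hom_ext {Z : M} {f g : obj ⟶ Z} (hb : base ≫ f = base ≫ g)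
    (hg : ∀ s hs, glue s hs ≫ f = glue s hs ≫ g) : f = g
  exists_desc {Z : M} (x : X.obj j ⟶ Z) (y : ∀ s, s < j → (E s ⟶ Z))
    (hxy : ∀ s hs, t s ≫ y s hs = X.map (homOfLE (Order.succ_le_of_lt hs)) ≫ x) :
    ∃ d : obj ⟶ Z, base ≫ d = x ∧ ∀ s hs, glue s hs ≫ d = y s hs

lemma nonempty_gluedObject [HasColimits M] {X : J ⥤ M} {E : J → M}
    (t : ∀ s, X.obj (Order.succ s) ⟶ E s) (j : J) : Nonempty (GluedObject t j) := by
  let f : (∐ fun s : Set.Iio j => X.obj (Order.succ s.1)) ⟶ X.obj j :=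
    Sigma.desc fun s => X.map (homOfLE (Order.succ_le_of_lt s.2))
  let g : (∐ fun s : Set.Iio j => X.obj (Order.succ s.1)) ⟶ ∐ fun s : Set.Iio j => E s.1 :=
    Limits.Sigma.map fun s : Set.Iio j => t s.1
  have hf (s : Set.Iio j) : Sigma.ι (fun s : Set.Iio j => X.obj (Order.succ s.1)) s ≫ f =
    X.map (homOfLE (Order.succ_le_of_lt s.2)) := Sigma.ι_desc _ _
  have hg (s : Set.Iio j) : Sigma.ι (fun s : Set.Iio j => X.obj (Order.succ s.1)) s ≫ g =
    t s.1 ≫ Sigma.ι (fun s : Set.Iio j => E s.1) s := Sigma.ι_map _ _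
  exact ⟨{
    obj := pushout f g
    base := pushout.inl f g
    glue := fun s hs => Sigma.ι (fun s : Set.Iio j => E s.1) ⟨s, hs⟩ ≫ pushout.inr f g
    w := fun s hs => by
      rw [← reassoc_of% hg ⟨s, hs⟩, ← pushout.condition, reassoc_of% hf ⟨s, hs⟩]
    hom_ext := fun {Z a b} hb h => pushout.hom_ext hb (Sigma.hom_ext _ _ fun s => by
      simpa using h s.1 s.2)
    exists_desc := fun {Z} x y hxy => ⟨pushout.desc x (Sigma.desc fun s : Set.Iio j => y s.1 s.2)
      (Sigma.hom_ext _ _ fun s => by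
        rw [reassoc_of% hf s, reassoc_of% hg s, Sigma.ι_desc]
        exact (hxy s.1 s.2).symm),
      pushout.inl_desc _ _ _, fun s hs => (Category.assoc _ _ _).trans
        ((congrArg (_ ≫ ·) (pushout.inr_desc _ _ _)).trans (Sigma.ι_desc _ _))⟩ }⟩

/-- A functorial choice of glued objects. -/
structure Gluing {X : J ⥤ M} {E : J → M} (t : ∀ s, X.obj (Order.succ s) ⟶ E s) where
  /-- the functor -/
  functor : J ⥤ M
  /-- the inclusions of the base -/
  base (j : J) : X.obj j ⟶ functor.obj j
  /-- the inclusions of the glued objects -/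
  glue (j s : J) (hs : s < j) : E s ⟶ functor.obj j
  w (j s : J) (hs : s < j) :
    t s ≫ glue j s hs = X.map (homOfLE (Order.succ_le_of_lt hs)) ≫ base j
  hom_ext (j : J) {Z : M} {f g : functor.obj j ⟶ Z} (hb : base j ≫ f = base j ≫ g)
    (hg : ∀ s hs, glue j s hs ≫ f = glue j s hs ≫ g) : f = g
  exists_desc (j : J) {Z : M} (x : X.obj j ⟶ Z) (y : ∀ s, s < j → (E s ⟶ Z))
    (hxy : ∀ s hs, t s ≫ y s hs = X.map (homOfLE (Order.succ_le_of_lt hs)) ≫ x) :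
    ∃ d : functor.obj j ⟶ Z, base j ≫ d = x ∧ ∀ s hs, glue j s hs ≫ d = y s hs
  base_map {i j : J} (f : i ⟶ j) : base i ≫ functor.map f = X.map f ≫ base j
  glue_map {i j : J} (f : i ⟶ j) (s : J) (hs : s < i) :
    glue i s hs ≫ functor.map f = glue j s (hs.trans_le (leOfHom f))

lemma nonempty_gluing [HasColimits M] {X : J ⥤ M} {E : J → M}
    (t : ∀ s, X.obj (Order.succ s) ⟶ E s) : Nonempty (Gluing t) := by
  have G (j : J) : GluedObject t j := (nonempty_gluedObject t j).some
  have key {i j : J} (f : i ⟶ j) : ∃ d : (G i).obj ⟶ (G j).obj,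
      (G i).base ≫ d = X.map f ≫ (G j).base ∧
      ∀ s hs, (G i).glue s hs ≫ d = (G j).glue s (hs.trans_le (leOfHom f)) :=
    (G i).exists_desc _ _ fun s hs => by
      rw [(G j).w, ← Category.assoc, ← X.map_comp]
      rfl
  choose m hm hm' using @key
  exact ⟨{
    functor :=
      { obj := fun j => (G j).obj
        map := fun f => m f
        map_id := fun j => (G j).hom_ext (by simp [hm]) (fun s hs => by simp [hm'])
        map_comp := fun {i j k} f g => (G i).hom_ext
          (by rw [hm, reassoc_of% hm f, hm, X.map_comp, Category.assoc])
          (fun s hs => by rw [hm', reassoc_of% hm' f, hm']) }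
    base := fun j => (G j).base
    glue := fun j => (G j).glue
    w := fun j => (G j).w
    hom_ext := fun j => (G j).hom_ext
    exists_desc := fun j => (G j).exists_desc
    base_map := fun f => hm f
    glue_map := fun f => hm' f }⟩

namespace Gluing

variable {X : J ⥤ M} {E : J → M} {t : ∀ s, X.obj (Order.succ s) ⟶ E s} (G : Gluing t)

/-- Below a limit `m`, each `E s` is already glued in at stage `s + 1 < m`, so nothing new appears
at `m` besides the colimit of the bases. -/
instance [OrderBot J] [X.IsWellOrderContinuous] : G.functor.IsWellOrderContinuous :=
  isWellOrderContinuous_of_existsUnique _ fun m hm Z z hz => by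
    obtain ⟨x, hx, hx'⟩ := existsUnique_of_isWellOrderContinuous X m hm
      (fun j hj => G.base j ≫ z j hj) (fun i j hij hj => by
        rw [← hz i j hij hj, ← Category.assoc, ← Category.assoc, G.base_map])
    have hs' {s : J} (hs : s < m) : Order.succ s < m := hm.succ_lt hs
    obtain ⟨d, hd, hd'⟩ := G.exists_desc m x
      (fun s hs => G.glue (Order.succ s) s (Order.lt_succ_of_not_isMax (not_isMax_of_lt hs)) ≫
        z (Order.succ s) (hs' hs))
      (fun s hs => by
        rw [reassoc_of% G.w (Order.succ s) s, hx _ (hs' hs)]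
        have : X.map (homOfLE (le_refl (Order.succ s))) = 𝟙 _ := X.map_id _
        erw [this, Category.id_comp])
    refine ⟨d, fun j hj => G.hom_ext j ?_ fun s hs => ?_, fun d' h => G.hom_ext m ?_ fun s hs => ?_⟩
    · rw [← Category.assoc, G.base_map, Category.assoc, hd, hx]
    · rw [← Category.assoc, G.glue_map, hd', ← hz (Order.succ s) j (Order.succ_le_of_lt hs) hj,
        ← Category.assoc, G.glue_map]
    · rw [hd]
      refine hx' _ fun j hj => ?_
      rw [← h j hj, ← Category.assoc, ← Category.assoc, G.base_map]
    · rw [hd', ← h (Order.succ s) (hs' hs), ← Category.assoc, G.glue_map]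

/-- Gluing `E j` along all of `X (j + 1)` absorbs that base. What remains is `E j` with the earlier
`E s` attached through `X j`, that is, `E j` glued to stage `j` along `e j`. -/
lemma isPushout_succ [NoMaxOrder J] {e : ∀ s, X.obj s ⟶ E s}
    (het : ∀ s, X.map (homOfLE (Order.le_succ s)) ≫ t s = e s) (j : J) :
    IsPushout (e j) (G.base j) (G.glue (Order.succ j) j (Order.lt_succ j))
      (G.functor.map (homOfLE (Order.le_succ j))) := by
  have comm : e j ≫ G.glue (Order.succ j) j (Order.lt_succ j) =
      G.base j ≫ G.functor.map (homOfLE (Order.le_succ j)) := by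
    rw [G.base_map, ← het, Category.assoc, G.w]
    have : X.map (homOfLE (le_refl (Order.succ j))) = 𝟙 _ := X.map_id _
    erw [this, Category.id_comp]
  have hd (s : PushoutCocone (e j) (G.base j)) : ∃ d : G.functor.obj (Order.succ j) ⟶ s.pt,
      G.glue (Order.succ j) j (Order.lt_succ j) ≫ d = s.inl ∧
      G.functor.map (homOfLE (Order.le_succ j)) ≫ d = s.inr := by
    -- The map on `E i` is chosen by cases, `i < j` or `i = j`. The transport `eqToHom` records the
    -- second case for a variable index.
    have key (i : J) (hi : i < Order.succ j) : ∃ y : E i ⟶ s.pt,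
        t i ≫ y = X.map (homOfLE (Order.succ_le_of_lt hi)) ≫ t j ≫ s.inl ∧
        (∀ h : i < j, y = G.glue j i h ≫ s.inr) ∧
        ∀ h : i = j, y = eqToHom (congrArg E h) ≫ s.inl := by
      obtain h | rfl := (Order.le_of_lt_succ hi).lt_or_eq
      · refine ⟨G.glue j i h ≫ s.inr, ?_, fun _ => rfl, fun h' => (h.ne h').elim⟩
        rw [reassoc_of% G.w j i h, ← s.condition, ← reassoc_of% het j,
          ← X.map_comp_assoc]
        rfl
      · refine ⟨s.inl, ?_, fun h => (lt_irrefl _ h).elim, fun _ => by simp⟩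
        have : X.map (homOfLE (le_refl (Order.succ i))) = 𝟙 _ := X.map_id _
        erw [this, Category.id_comp]
    choose y hy hy₁ hy₂ using key
    obtain ⟨d, hd, hd'⟩ := G.exists_desc (Order.succ j) (t j ≫ s.inl) y hy
    refine ⟨d, by rw [hd', hy₂ _ _ rfl]; simp, G.hom_ext j ?_ fun i hi => ?_⟩
    · rw [← Category.assoc, G.base_map, Category.assoc, hd, reassoc_of% het j, s.condition]
    · rw [← Category.assoc, G.glue_map, hd', hy₁]
  choose d hd hd' using hd
  refine ⟨⟨comm⟩, ⟨PushoutCocone.IsColimit.mk comm d hd hd' fun s m h₁ h₂ => ?_⟩⟩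
  refine G.hom_ext _ ?_ fun i hi => ?_
  · have h (f : G.functor.obj (Order.succ j) ⟶ s.pt) : G.base (Order.succ j) ≫ f =
        t j ≫ G.glue (Order.succ j) j (Order.lt_succ j) ≫ f := by
      rw [reassoc_of% G.w (Order.succ j) j (Order.lt_succ j)]
      have : X.map (homOfLE (le_refl (Order.succ j))) = 𝟙 _ := X.map_id _
      erw [this, Category.id_comp]
    rw [h, h, h₁, hd]
  · obtain h | rfl := (Order.le_of_lt_succ hi).lt_or_eq
    · rw [← G.glue_map (homOfLE (Order.le_succ j)) i h, Category.assoc, Category.assoc, h₂, hd']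
    · rw [h₁, hd]

/-- The base is a retract of the gluing, if the maps `t s` are split monomorphisms. -/
lemma exists_retraction {p : ∀ s, E s ⟶ X.obj (Order.succ s)} (htp : ∀ s, t s ≫ p s = 𝟙 _) :
    ∃ (i : X ⟶ G.functor) (r : G.functor ⟶ X), i ≫ r = 𝟙 X := by
  have key (j : J) := G.exists_desc j (𝟙 (X.obj j))
    (fun s hs => p s ≫ X.map (homOfLE (Order.succ_le_of_lt hs)))
    (fun s hs => by rw [reassoc_of% htp s, Category.comp_id])
  choose r hr hr' using key
  refine ⟨{ app := G.base, naturality := fun _ _ f => (G.base_map f).symm },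
    { app := r, naturality := fun i j f => G.hom_ext i ?_ fun s hs => ?_ }, ?_⟩
  · rw [← Category.assoc, G.base_map, Category.assoc, hr, reassoc_of% hr i, Category.comp_id]
  · rw [← Category.assoc, G.glue_map, hr', reassoc_of% hr' i, ← X.map_comp]
    rfl
  · ext j
    exact hr j

end Gluing

end Gluing

/-! ### Smallness relative to retracts of cell complexes -/

section Smallness

/-- The colimit of `X` is a retract of that of `W`, so a cocone on the image of `X` can be extended
over the image of `W` and then restricted. -/
lemma preservesColimit_of_retract {M N K : Type*} [Category* M] [Category* N] [Category* K]
    {X W : K ⥤ M} (i : X ⟶ W) (r : W ⟶ X) (hir : i ≫ r = 𝟙 X) [HasColimit W] (G : M ⥤ N)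
    [PreservesColimit W G] : PreservesColimit X G where
  preserves {c} hc := by
    have hir' (k : K) : i.app k ≫ r.app k = 𝟙 (X.obj k) := NatTrans.congr_app hir k
    let i' : c.pt ⟶ colimit W := hc.desc (Cocone.mk _ (i ≫ (colimit.cocone W).ι))
    have hi' (k : K) : c.ι.app k ≫ i' = i.app k ≫ colimit.ι W k := hc.fac _ _
    let r' : colimit W ⟶ c.pt := colimit.desc W (Cocone.mk _ (r ≫ c.ι))
    have hr' (k : K) : colimit.ι W k ≫ r' = r.app k ≫ c.ι.app k := colimit.ι_desc _ _
    have hir'' : i' ≫ r' = 𝟙 _ := hc.hom_ext fun k => by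
      rw [reassoc_of% hi' k, hr', reassoc_of% hir' k, Category.comp_id]
    have hW := isColimitOfPreserves G (colimit.isColimit W)
    have key (s : Cocone (X ⋙ G)) : ∃ d : G.obj (colimit W) ⟶ s.pt,
        ∀ k, G.map (colimit.ι W k) ≫ d = G.map (r.app k) ≫ s.ι.app k :=
      ⟨hW.desc (Cocone.mk _ (Functor.whiskerRight r G ≫ s.ι)), fun k => hW.fac _ k⟩
    choose d hd using key
    refine ⟨{
      desc := fun s => G.map i' ≫ d s
      fac := fun s k => ?_
      uniq := fun s m hm => ?_ }⟩
    · change G.map (c.ι.app k) ≫ G.map i' ≫ d s = s.ι.app k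
      rw [← G.map_comp_assoc, hi', G.map_comp_assoc, hd, ← G.map_comp_assoc, hir', G.map_id,
        Category.id_comp]
    · have h : G.map r' ≫ m = d s := hW.hom_ext fun k => by
        change G.map (colimit.ι W k) ≫ G.map r' ≫ m = G.map (colimit.ι W k) ≫ d s
        rw [hd, ← G.map_comp_assoc, hr', G.map_comp_assoc]
        exact congrArg _ (hm k)
      rw [← h, ← G.map_comp_assoc, hir'', G.map_id, Category.id_comp]

variable {M : Type u} [Category.{v} M]

/-- The cocone of a colimit presents the inclusion of the first object as a transfinite
composition. -/
noncomputable def transfiniteCompositionOfShapeColimit {J : Type v} [LinearOrder J] [SuccOrder J]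
    [OrderBot J] [WellFoundedLT J] [HasColimits M] (W : MorphismProperty M) (F : J ⥤ M)
    [F.IsWellOrderContinuous]
    (h : ∀ j, W (F.map (homOfLE (Order.le_succ j)))) :
    W.TransfiniteCompositionOfShape J (colimit.ι F ⊥) where
  F := F
  isoBot := Iso.refl _
  incl := (colimit.cocone F).ι
  isColimit := colimit.isColimit F
  fac := Category.id_comp _
  map_mem j _ := h j

/-- Objects that are small relative to the relative `I`-cell complexes are small relative to the
larger class `I.rlp.llp`. -/
lemma IsSmallRelativeTo.llp_rlp [HasColimits M] {I : MorphismProperty M} {A : M}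
    (hI : ∀ ⦃X Y : M⦄ (f : X ⟶ Y), ∃ (E : M) (e : X ⟶ E) (p : E ⟶ Y),
      relativeCells I e ∧ I.rlp p ∧ e ≫ p = f)
    (hA : IsSmallRelativeTo A (relativeCells I)) : IsSmallRelativeTo A I.rlp.llp := by
  obtain ⟨κ, hκ⟩ := hA
  refine ⟨κ, fun μ hμ _ _ X Y f hf => ?_⟩
  have : NoMaxOrder μ.ord.ToType :=
    Cardinal.noMaxOrder (Fact.elim inferInstance : μ.IsRegular).aleph0_le
  choose E e p he hp hep using fun s => hI (hf.F.map (homOfLE (Order.le_succ s)))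
  -- The retract argument for each successor map. Gluing along the sections `t` makes these separate
  -- retracts compatible: the sequence becomes a retract of a sequence of relative cells.
  have hlift (s) : ∃ t : hf.F.obj (Order.succ s) ⟶ E s,
      hf.F.map (homOfLE (Order.le_succ s)) ≫ t = e s ∧ t ≫ p s = 𝟙 _ := by
    have sq : CommSq (e s) (hf.F.map (homOfLE (Order.le_succ s))) (p s) (𝟙 _) :=
      ⟨by rw [hep, Category.comp_id]⟩
    have := hf.map_mem s (not_isMax s) _ (hp s)
    exact ⟨sq.lift, sq.fac_left, sq.fac_right⟩
  choose t ht htp using hlift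
  obtain ⟨G⟩ := nonempty_gluing t
  have := hf.isWellOrderContinuous
  have hG (j) : relativeCells I (G.functor.map (homOfLE (Order.le_succ j))) :=
    relativeCells_of_isPushout (G.isPushout_succ ht j) (he j)
  have := hκ μ hμ _ (transfiniteCompositionOfShapeColimit (relativeCells I) G.functor hG)
  obtain ⟨i, r, hir⟩ := G.exists_retraction htp
  have : PreservesColimit G.functor (coyoneda.obj (op A)) := this
  exact preservesColimit_of_retract i r hir _

lemma PermitsSmallObjectArgument.hasSmallObjectArgument [HasColimits M] {I : MorphismProperty M}
    (hI : PermitsSmallObjectArgument I) :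
    MorphismProperty.HasSmallObjectArgument.{v} I := by
  obtain ⟨hsmall, hI⟩ := hI
  choose κ hκ using fun i : I.toSet => hI i.1.hom i.2
  have : Small.{v} I.toSet := hsmall.small_toSet
  obtain ⟨κ', hκ'⟩ := Cardinal.bddAbove_of_small (s := Set.range κ)
  -- A successor of an infinite cardinal is regular, and this one exceeds the smallness bounds of
  -- all generators, of which there is only a small set.
  let μ := Order.succ (max Cardinal.aleph0 κ')
  have hμ : Fact μ.IsRegular := ⟨Cardinal.isRegular_succ (le_max_left _ _)⟩
  have : Nonempty μ.ord.ToType := by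
    rw [Ordinal.nonempty_toType_iff, Ne, Cardinal.ord_eq_zero]
    exact hμ.out.ne_zero
  let hbot : OrderBot μ.ord.ToType := WellFoundedLT.toOrderBot _
  refine ⟨⟨μ, hμ, hbot, { preservesColimit := ?_ }⟩⟩
  intro A B X Y i hi f hf
  refine hκ ⟨Arrow.mk i, hi⟩ μ
    ((hκ' ⟨_, rfl⟩).trans ((le_max_right _ _).trans (Order.le_succ _))) f
    ((hf.transfiniteCompositionOfShape _).ofLE ?_)
  rw [I.ofHoms_homFamily]
  exact MorphismProperty.le_transfiniteCompositions _

lemma relativeCells_le_llp_rlp (I : MorphismProperty M) : relativeCells I ≤ I.rlp.llp :=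
  MorphismProperty.transfiniteCompositions_pushouts_coproducts_le_llp_rlp I

lemma exists_relativeCells_rlp_factorization (I : MorphismProperty M)
    [hI : MorphismProperty.HasSmallObjectArgument.{v} I] ⦃X Y : M⦄ (f : X ⟶ Y) :
    ∃ (E : M) (e : X ⟶ E) (p : E ⟶ Y), relativeCells I e ∧ I.rlp p ∧ e ≫ p = f := by
  obtain ⟨κ, hκ, hbot, hI⟩ := hI
  exact ⟨_, SmallObject.ιObj I κ f, SmallObject.πObj I κ f,
    MorphismProperty.transfiniteCompositionsOfShape_le_transfiniteCompositions _ _ _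
      (SmallObject.transfiniteCompositionsOfShape_ιObj I κ f),
    SmallObject.rlp_πObj I κ f, SmallObject.ιObj_πObj I κ f⟩

end Smallness

/-! ### Existence of the projective model structure -/

section ProjectiveModelStructure

variable {V : Type u} [Category.{v} V] [MonoidalCategory V] [SymmetricCategory V]
  [MonoidalClosed V] {C : Type v} [EnrichedCategory V C]

namespace VPresheaf

variable (C) in
/-- The free presheaf morphisms on a class of morphisms of `V`. -/
def freeCells (I : MorphismProperty V) : MorphismProperty (VPresheaf V C) :=
  MorphismProperty.ofHoms fun p : C × I.toSet => (free p.1).map p.2.1.hom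

variable {I : MorphismProperty V}

lemma rlp_freeCells_iff {X Y : VPresheaf V C} (p : X ⟶ Y) :
    (freeCells C I).rlp p ↔ ∀ c, I.rlp (p.app c) := by
  constructor
  · intro h c A B i hi
    exact ((freeAdjunction c).hasLiftingProperty_iff i p).1
      (h _ (MorphismProperty.ofHoms.mk (f := fun p : C × I.toSet => (free p.1).map p.2.1.hom)
        (c, ⟨Arrow.mk i, hi⟩)))
  · rintro h _ _ _ ⟨c, i⟩
    exact ((freeAdjunction c).hasLiftingProperty_iff i.1.hom p).2 (h c _ i.2)

/-- The cotensors by the hom-objects of `C` preserve the class `I.rlp`. -/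
def HomsPreserveRLP (C : Type v) [EnrichedCategory V C] (I : MorphismProperty V) : Prop :=
  ∀ (c c' : C) ⦃X Y : V⦄ (p : X ⟶ Y), I.rlp p → I.rlp ((ihom (c ⟶[V] c')).map p)

/-- Lifting `f.app c` against `p` is lifting `f` against the cofree map on `p`, whose components are
cotensors of `p` by hom-objects. -/
lemma llp_rlp_app (hC : HomsPreserveRLP C I) {X Y : VPresheaf V C} {f : X ⟶ Y}
    (hf : (freeCells C I).rlp.llp f) (c : C) : I.rlp.llp (f.app c) := fun _ _ p hp =>
  ((cofreeAdjunction c).hasLiftingProperty_iff f p).2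
    (hf _ ((rlp_freeCells_iff _).2 fun c' => hC c c' p hp))

/-- Maps out of the free presheaf on `A` are maps from `A` to the value at `c`, and evaluation
preserves colimits. Evaluated cells are only known to lie in `I.rlp.llp`, which dictates the
hypothesis on `A`. -/
lemma isSmallRelativeTo_free_obj [HasColimits V] (hC : HomsPreserveRLP C I) {A : V}
    (hA : IsSmallRelativeTo A I.rlp.llp) (c : C) :
    IsSmallRelativeTo ((free c).obj A) (relativeCells (freeCells C I)) := by
  obtain ⟨κ, hκ⟩ := hA
  refine ⟨κ, fun μ hμ _ _ X Y f hf => ?_⟩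
  have : PreservesColimitsOfSize.{v, v} (evaluation V c) :=
    (cofreeAdjunction c).leftAdjoint_preservesColimits
  let hf' : (I.rlp.llp.inverseImage (evaluation V c)).TransfiniteCompositionOfShape
      μ.ord.ToType f :=
    hf.ofLE fun _ _ g hg => llp_rlp_app hC (relativeCells_le_llp_rlp _ _ hg) c
  have : PreservesWellOrderContinuousOfShape μ.ord.ToType (evaluation V c) := {}
  have := hκ μ hμ _ hf'.map
  have : PreservesColimit (hf.F ⋙ evaluation V c) (coyoneda.obj (op A)) := this
  have : PreservesColimit hf.F (evaluation V c ⋙ coyoneda.obj (op A)) := inferInstance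
  let e : evaluation V c ⋙ coyoneda.obj (op A) ≅ coyoneda.obj (op ((free c).obj A)) :=
    ((freeAdjunction c).compCoyonedaIso.app (op A)).symm
  exact preservesColimit_of_natIso _ e

lemma permitsSmallObjectArgument_freeCells [HasColimits V] (hC : HomsPreserveRLP C I)
    (hI : PermitsSmallObjectArgument I) : PermitsSmallObjectArgument (freeCells C I) := by
  have := hI.hasSmallObjectArgument
  have : Small.{v} I.toSet := hI.1.small_toSet
  refine ⟨by rw [freeCells]; infer_instance, ?_⟩
  rintro _ _ _ ⟨c, i⟩
  exact isSmallRelativeTo_free_obj hC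
    ((hI.2 _ i.2).llp_rlp (exists_relativeCells_rlp_factorization I)) c

variable [ModelCategory V]

-- Adjoint form of the first half of flatness: tensoring with a hom-object preserves cofibrations.
omit [SymmetricCategory V] in
lemma homsPreserveRLP_of_eq_trivialFibrations (hC : IsLocallyFlat V C)
    (hI : trivialFibrations V = I.rlp) : HomsPreserveRLP C I := fun c c' X Y p hp => by
  rw [← hI] at hp ⊢
  rw [← cofibrations_rlp]
  intro A B i hi
  rw [← (ihom.adjunction (c ⟶[V] c')).hasLiftingProperty_iff]
  have : Cofibration ((c ⟶[V] c') ◁ i) := (hC c c').cofibration i ((cofibration_iff i).2 hi)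
  obtain ⟨_, _⟩ := (mem_trivialFibrations_iff p).1 hp
  exact inferInstanceAs (HasLiftingProperty ((c ⟶[V] c') ◁ i) p)

omit [SymmetricCategory V] in
lemma homsPreserveRLP_of_eq_fibrations (hC : IsLocallyFlat V C)
    (hI : fibrations V = I.rlp) : HomsPreserveRLP C I := fun c c' X Y p hp => by
  rw [← hI] at hp ⊢
  rw [← trivialCofibrations_rlp]
  intro A B i hi
  rw [← (ihom.adjunction (c ⟶[V] c')).hasLiftingProperty_iff]
  obtain ⟨_, _⟩ := (mem_trivialCofibrations_iff i).1 hi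
  obtain ⟨_, _⟩ := (hC c c').trivialCofibration i inferInstance inferInstance
  have := (fibration_iff p).2 hp
  exact inferInstanceAs (HasLiftingProperty ((c ⟶[V] c') ◁ i) p)

variable (V C) in
/-- The pointwise fibrations. -/
def pointwiseFibrations : MorphismProperty (VPresheaf V C) :=
  fun _ _ f => ∀ c, Fibration (f.app c)

variable (V C) in
/-- The pointwise weak equivalences. -/
def pointwiseWeakEquivalences : MorphismProperty (VPresheaf V C) :=
  fun _ _ f => ∀ c, WeakEquivalence (f.app c)

instance : (pointwiseWeakEquivalences V C).HasTwoOutOfThreeProperty where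
  comp_mem f g hf hg c := by
    have := hf c
    have := hg c
    exact inferInstanceAs (WeakEquivalence (f.app c ≫ g.app c))
  of_postcomp f g hg hfg c := by
    have := hg c
    have : WeakEquivalence (f.app c ≫ g.app c) := hfg c
    exact weakEquivalence_of_postcomp (f.app c) (g.app c)
  of_precomp f g hf hfg c := by
    have := hf c
    have : WeakEquivalence (f.app c ≫ g.app c) := hfg c
    exact weakEquivalence_of_precomp (f.app c) (g.app c)

lemma rlp_freeCells_eq_inf (hI : trivialFibrations V = I.rlp) :
    (freeCells C I).rlp = pointwiseFibrations V C ⊓ pointwiseWeakEquivalences V C := by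
  ext X Y p
  rw [rlp_freeCells_iff]
  simp only [← hI, mem_trivialFibrations_iff]
  exact forall_and

lemma rlp_freeCells_eq {J : MorphismProperty V} (hJ : fibrations V = J.rlp) :
    (freeCells C J).rlp = pointwiseFibrations V C := by
  ext X Y p
  rw [rlp_freeCells_iff]
  simp only [← hJ, ← fibration_iff]
  rfl

/-- Flatness enters through `llp_rlp_app`, making the maps generated by `J` pointwise trivial
cofibrations. The other inclusion is the retract argument. -/
lemma llp_rlp_freeCells_eq {J : MorphismProperty V} (hC : IsLocallyFlat V C)
    (hI : trivialFibrations V = I.rlp) (hJ : fibrations V = J.rlp)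
    [MorphismProperty.HasSmallObjectArgument.{v} (freeCells C J)] :
    (freeCells C J).rlp.llp = (freeCells C I).rlp.llp ⊓ pointwiseWeakEquivalences V C := by
  have hw : (freeCells C J).rlp.llp ≤ pointwiseWeakEquivalences V C := fun X Y f hf c => by
    have := llp_rlp_app (homsPreserveRLP_of_eq_fibrations hC hJ) hf c
    rw [← hJ, fibrations_llp] at this
    exact ((mem_trivialCofibrations_iff _).1 this).2
  refine le_antisymm (le_inf (MorphismProperty.antitone_llp ?_) hw) ?_
  · rw [rlp_freeCells_eq_inf hI, rlp_freeCells_eq hJ]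
    exact inf_le_left
  · rintro X Y f ⟨hf, hfw⟩
    let h := MorphismProperty.factorizationData (freeCells C J).rlp.llp (freeCells C J).rlp f
    -- By two out of three `h.p` is also a pointwise weak equivalence, so `f` lifts against it and
    -- is a retract of `h.i`.
    have hp : (freeCells C I).rlp h.p := by
      rw [rlp_freeCells_eq_inf hI, ← rlp_freeCells_eq hJ]
      refine ⟨h.hp, ?_⟩
      exact MorphismProperty.of_precomp _ h.i h.p (hw _ h.hi) (by rwa [h.fac])
    have := hf _ hp
    exact MorphismProperty.of_retract (RetractArrow.ofLeftLiftingProperty h.fac) h.hi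

end VPresheaf

open VPresheaf in
theorem exists_isProjectiveModelStructure [HasLimits V] [HasColimits V] [ModelCategory V]
    (hV : IsCofibrantlyGenerated V) (hC : IsLocallyFlat V C) :
    ∃ M : ModelCategory (VPresheaf V C), IsProjectiveModelStructure M := by
  obtain ⟨I, J, hIs, hJs, hI, hJ⟩ := hV
  have : HasColimits (VPresheaf V C) := ⟨fun _ _ => inferInstance⟩
  have := (permitsSmallObjectArgument_freeCells (C := C)
    (homsPreserveRLP_of_eq_trivialFibrations hC hI) hIs).hasSmallObjectArgument
  have := (permitsSmallObjectArgument_freeCells (C := C)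
    (homsPreserveRLP_of_eq_fibrations hC hJ) hJs).hasSmallObjectArgument
  let : CategoryWithFibrations (VPresheaf V C) := ⟨pointwiseFibrations V C⟩
  let : CategoryWithWeakEquivalences (VPresheaf V C) := ⟨pointwiseWeakEquivalences V C⟩
  let : CategoryWithCofibrations (VPresheaf V C) := ⟨(freeCells C I).rlp.llp⟩
  have h₁ : trivialFibrations (VPresheaf V C) = (freeCells C I).rlp :=
    (rlp_freeCells_eq_inf hI).symm
  have h₂ : trivialCofibrations (VPresheaf V C) = (freeCells C J).rlp.llp :=
    (llp_rlp_freeCells_eq hC hI hJ).symm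
  have h₃ : fibrations (VPresheaf V C) = (freeCells C J).rlp := (rlp_freeCells_eq hJ).symm
  have h₄ : cofibrations (VPresheaf V C) = (freeCells C I).rlp.llp := rfl
  have : (weakEquivalences (VPresheaf V C)).HasTwoOutOfThreeProperty :=
    inferInstanceAs (pointwiseWeakEquivalences V C).HasTwoOutOfThreeProperty
  have : MorphismProperty.IsWeakFactorizationSystem (cofibrations (VPresheaf V C))
      (trivialFibrations (VPresheaf V C)) := by
    rw [h₁, h₄]
    exact { rlp := MorphismProperty.rlp_llp_rlp _, llp := rfl }
  have : MorphismProperty.IsWeakFactorizationSystem (trivialCofibrations (VPresheaf V C))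
      (fibrations (VPresheaf V C)) := by
    rw [h₂, h₃]
    exact { rlp := MorphismProperty.rlp_llp_rlp _, llp := rfl }
  have : HasFiniteLimits (VPresheaf V C) := ⟨fun _ _ _ => inferInstance⟩
  have : HasFiniteColimits (VPresheaf V C) := ⟨fun _ _ _ => inferInstance⟩
  exact ⟨ModelCategory.mk' _, ⟨fun X Y f => fibration_iff f, fun X Y f => weakEquivalence_iff f⟩⟩

end ProjectiveModelStructure

/-! ### Homotopy theory of flat objects -/

section FlatObjects

variable {V : Type u} [Category.{v} V] [MonoidalCategory V] [ModelCategory V]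

lemma IsFlatObject.isQuillenAdjunction [MonoidalClosed V] {K : V} (hK : IsFlatObject K) :
    IsQuillenAdjunction (ihom.adjunction K) where
  cofibration _ _ f hf := hK.cofibration f hf
  trivialCofibration _ _ f hf hf' := hK.trivialCofibration f hf hf'

lemma IsFlatObject.isCofibrant_tensor [MonoidalClosed V] {K : V} (hK : IsFlatObject K) (A : V)
    [IsCofibrant A] : IsCofibrant (K ⊗ A) :=
  hK.isQuillenAdjunction.isCofibrant_obj A

lemma IsFlatObject.weakEquivalence_whiskerLeft {K : V} (hK : IsFlatObject K) {A B : V}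
    [IsCofibrant A] [IsCofibrant B] (f : A ⟶ B) [WeakEquivalence f] : WeakEquivalence (K ◁ f) :=
  weakEquivalence_map_of_isCofibrant (tensorLeft K)
    (fun _ _ g hg hg' => (hK.trivialCofibration g hg hg').2) f

variable [SymmetricCategory V]

/-- Left and right whiskering are isomorphic. -/
def arrowWhiskerIso {X Y : V} (f : X ⟶ Y) (A : V) : Arrow.mk (A ◁ f) ≅ Arrow.mk (f ▷ A) :=
  Arrow.isoMk (β_ A X) (β_ A Y) (BraidedCategory.braiding_naturality_right A f).symm

lemma weakEquivalence_whiskerLeft_iff {X Y : V} (f : X ⟶ Y) (A : V) :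
    WeakEquivalence (A ◁ f) ↔ WeakEquivalence (f ▷ A) := by
  rw [weakEquivalence_iff, weakEquivalence_iff]
  exact (weakEquivalences V).arrow_mk_iso_iff (arrowWhiskerIso f A)

lemma cofibration_whiskerLeft_iff {X Y : V} (f : X ⟶ Y) (A : V) :
    Cofibration (A ◁ f) ↔ Cofibration (f ▷ A) := by
  rw [cofibration_iff, cofibration_iff]
  exact (cofibrations V).arrow_mk_iso_iff (arrowWhiskerIso f A)

variable [MonoidalClosed V]

-- Tensoring with the initial object gives an initial object, so the pushout defining the corner
-- collapses to `X ⊗ A`.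
omit [SymmetricCategory V] in
lemma nonempty_arrowIso_pushoutProduct_initial {X Y : V} (f : X ⟶ Y) (A : V) :
    Nonempty (Arrow.mk (f ▷ A) ≅ Arrow.mk
      ((MonoidalCategory.Arrow.pushoutProduct.obj (Arrow.mk f)).obj
        (Arrow.mk (initial.to A))).hom) := by
  let S := Functor.PushoutObjObj.ofHasPushout (curriedTensor V) f (initial.to A)
  have hX (Z : V) : IsInitial (Z ⊗ ⊥_ V) := initialIsInitial.isInitialObj (tensorLeft Z) _
  have : IsIso (((curriedTensor V).map f).app (⊥_ V)) :=
    ⟨(hX Y).to _, (hX X).hom_ext _ _, (hX Y).hom_ext _ _⟩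
  have : IsIso S.inr := S.isPushout.isIso_inr_of_isIso
  let e := asIso S.inr
  exact ⟨Arrow.isoMk e (Iso.refl _) (S.inr_ι.trans (Category.comp_id _).symm)⟩

namespace IsMonoidalModelCategory

variable (hV : IsMonoidalModelCategory V)

include hV

lemma isFlatObject (A : V) [IsCofibrant A] : IsFlatObject A := by
  have hA : Cofibration (initial.to A) := inferInstance
  have hc ⦃X Y : V⦄ (f : X ⟶ Y) (hf : Cofibration f) : Cofibration (A ◁ f) := by
    obtain ⟨e⟩ := nonempty_arrowIso_pushoutProduct_initial f A
    have := hV.cofibration_pushoutProduct f (initial.to A) hf hA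
    rw [cofibration_iff] at this
    rw [cofibration_whiskerLeft_iff, cofibration_iff]
    exact ((cofibrations V).arrow_mk_iso_iff e).2 this
  refine ⟨hc, fun X Y f hf hf' => ⟨hc f hf, ?_⟩⟩
  obtain ⟨e⟩ := nonempty_arrowIso_pushoutProduct_initial f A
  have := hV.weakEquivalence_pushoutProduct f (initial.to A) hf hA (Or.inl hf')
  rw [weakEquivalence_iff] at this
  rw [weakEquivalence_whiskerLeft_iff, weakEquivalence_iff]
  exact ((weakEquivalences V).arrow_mk_iso_iff e).2 this

variable {Q : V} (q : Q ⟶ 𝟙_ V) [IsCofibrant Q] [WeakEquivalence q]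

/-- By the unit axiom `q ▷ A` is a weak equivalence; its ends are cofibrant, so Ken Brown's lemma
applies to `K ⊗ -`. -/
lemma weakEquivalence_whiskerLeft_resolution_tensor {K : V} (hK : IsFlatObject K) (A : V)
    [IsCofibrant A] : WeakEquivalence ((K ◁ q) ▷ A) := by
  have := hV.unit_axiom q inferInstance inferInstance A inferInstance
  have := (hV.isFlatObject Q).isCofibrant_tensor A
  have : IsCofibrant (𝟙_ V ⊗ A) :=
    isCofibrant_of_cofibration (λ_ A).inv
  have := hK.weakEquivalence_whiskerLeft (q ▷ A)
  rw [whisker_assoc]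
  infer_instance

/-- Tensoring a flat object with a cofibrant resolution of the unit is a weak equivalence. -/
lemma weakEquivalence_whiskerLeft_resolution {K : V} (hK : IsFlatObject K) :
    WeakEquivalence (K ◁ q) := by
  obtain ⟨P, p, _, _, _⟩ := exists_cofibrant_resolution K
  have := hK.isCofibrant_tensor Q
  -- `K ⊗ Q` is cofibrant although `K` may not be, so the map to `K` lifts to `P`. This lift,
  -- tensored with `Q`, starts the chain for two out of six.
  have sq : CommSq (initial.to P) (initial.to (K ⊗ Q)) p (K ◁ q ≫ (ρ_ K).hom) :=
    ⟨initialIsInitial.hom_ext _ _⟩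
  have h₁ : WeakEquivalence (sq.lift ▷ Q ≫ p ▷ Q) := by
    have := hV.weakEquivalence_whiskerLeft_resolution_tensor q hK Q
    rw [← comp_whiskerRight, sq.fac_right, comp_whiskerRight]
    infer_instance
  have h₂ : WeakEquivalence (p ▷ Q ≫ K ◁ q ≫ (ρ_ K).hom) := by
    have := (weakEquivalence_whiskerLeft_iff q P).2
      (hV.unit_axiom q inferInstance inferInstance P inferInstance)
    rw [← whisker_exchange_assoc, rightUnitor_naturality]
    infer_instance
  have := weakEquivalence_of_two_out_of_six (sq.lift ▷ Q) (p ▷ Q) (K ◁ q ≫ (ρ_ K).hom)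
  exact weakEquivalence_of_postcomp (K ◁ q) (ρ_ K).hom

include q in
/-- Weak equivalences between flat objects are detected by tensoring with a cofibrant resolution
of the unit. -/
lemma weakEquivalence_whiskerRight_iff {K K' : V} (hK : IsFlatObject K) (hK' : IsFlatObject K')
    (f : K ⟶ K') : WeakEquivalence (f ▷ Q) ↔ WeakEquivalence f := by
  have := hV.weakEquivalence_whiskerLeft_resolution q hK
  have := hV.weakEquivalence_whiskerLeft_resolution q hK'
  have e : f ▷ Q ≫ K' ◁ q ≫ (ρ_ K').hom = (K ◁ q ≫ (ρ_ K).hom) ≫ f := by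
    rw [← whisker_exchange_assoc, rightUnitor_naturality, Category.assoc]
  constructor
  · intro h
    have : WeakEquivalence ((K ◁ q ≫ (ρ_ K).hom) ≫ f) := by
      rw [← e]
      infer_instance
    exact weakEquivalence_of_precomp (K ◁ q ≫ (ρ_ K).hom) f
  · intro h
    have : WeakEquivalence (f ▷ Q ≫ K' ◁ q ≫ (ρ_ K').hom) := by
      rw [e]
      infer_instance
    exact weakEquivalence_of_postcomp (f ▷ Q) (K' ◁ q ≫ (ρ_ K').hom)

omit q [IsCofibrant Q] [WeakEquivalence q]

/-- Weak equivalences between flat objects are preserved by tensoring with cofibrant objects. -/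
lemma weakEquivalence_whiskerRight {K K' : V} (hK : IsFlatObject K) (hK' : IsFlatObject K')
    (f : K ⟶ K') [WeakEquivalence f] (A : V) [IsCofibrant A] : WeakEquivalence (f ▷ A) := by
  obtain ⟨Q, q, _, _, _⟩ := exists_cofibrant_resolution (𝟙_ V)
  have := hK.isCofibrant_tensor Q
  have := hK'.isCofibrant_tensor Q
  have := (hV.weakEquivalence_whiskerRight_iff q hK hK' f).2 inferInstance
  -- Ken Brown's lemma does not apply to `f` itself, whose ends need not be cofibrant, but it does
  -- apply to `f ▷ Q`. The result is then compared with `f ▷ A` along `q`.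
  have := (hV.isFlatObject A).weakEquivalence_whiskerLeft (f ▷ Q)
  have := (weakEquivalence_whiskerLeft_iff (f ▷ Q) A).1 inferInstance
  have := hV.weakEquivalence_whiskerLeft_resolution_tensor q hK A
  have := hV.weakEquivalence_whiskerLeft_resolution_tensor q hK' A
  have e : f ▷ Q ▷ A ≫ (K' ◁ q ≫ (ρ_ K').hom) ▷ A = (K ◁ q ≫ (ρ_ K).hom) ▷ A ≫ f ▷ A := by
    rw [← comp_whiskerRight, ← comp_whiskerRight, ← whisker_exchange_assoc,
      rightUnitor_naturality, Category.assoc]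
  have h : ∀ {L : V} (_ : WeakEquivalence ((L ◁ q) ▷ A)),
      WeakEquivalence ((L ◁ q ≫ (ρ_ L).hom) ▷ A) := fun _ => by
    rw [comp_whiskerRight]
    infer_instance
  have := @h K inferInstance
  have := @h K' inferInstance
  have : WeakEquivalence ((K ◁ q ≫ (ρ_ K).hom) ▷ A ≫ f ▷ A) := by
    rw [← e]
    infer_instance
  exact weakEquivalence_of_precomp ((K ◁ q ≫ (ρ_ K).hom) ▷ A) (f ▷ A)

/-- A weak equivalence of flat objects induces weak equivalences on internal homs into fibrant
objects. -/
lemma weakEquivalence_pre_app {K K' : V} (hK : IsFlatObject K) (hK' : IsFlatObject K')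
    (f : K ⟶ K') [WeakEquivalence f] (Y : V) [IsFibrant Y] :
    WeakEquivalence ((MonoidalClosed.pre f).app Y) :=
  hK.isQuillenAdjunction.weakEquivalence_of_conjugate_right hK'.isQuillenAdjunction Y
    (fun X => f ▷ X) ((MonoidalClosed.pre f).app Y)
    (fun _ g => (MonoidalClosed.curry_pre_app f g).symm)
    (fun X _ => hV.weakEquivalence_whiskerRight hK hK' f X)

end IsMonoidalModelCategory

end FlatObjects

/-! ### Recognizing Quillen adjunctions and equivalences -/

section QuillenEquivalences

variable {A B : Type*} [Category* A] [Category* B] [ModelCategory A] [ModelCategory B]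
  {L : A ⥤ B} {R : B ⥤ A} {adj : L ⊣ R}

lemma isQuillenAdjunction_of_rightAdjoint
    (h₁ : ∀ ⦃X Y : B⦄ (p : X ⟶ Y), Fibration p → Fibration (R.map p))
    (h₂ : ∀ ⦃X Y : B⦄ (p : X ⟶ Y), Fibration p → WeakEquivalence p → WeakEquivalence (R.map p)) :
    IsQuillenAdjunction adj := by
  refine ⟨fun X Y f hf => ?_, fun X Y f hf hf' => ?_⟩
  · rw [cofibration_iff, ← trivialFibrations_llp]
    intro _ _ p hp
    obtain ⟨_, _⟩ := (mem_trivialFibrations_iff p).1 hp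
    have := h₁ p inferInstance
    have := h₂ p inferInstance inferInstance
    rw [adj.hasLiftingProperty_iff]
    infer_instance
  · rw [← mem_trivialCofibrations_iff, ← fibrations_llp]
    intro _ _ p hp
    have := h₁ p ((fibration_iff p).2 hp)
    rw [adj.hasLiftingProperty_iff]
    infer_instance

lemma IsQuillenAdjunction.comp {E : Type*} [Category* E] [ModelCategory E] {L' : B ⥤ E}
    {R' : E ⥤ B} {adj' : L' ⊣ R'} (h : IsQuillenAdjunction adj) (h' : IsQuillenAdjunction adj') :
    IsQuillenAdjunction (adj.comp adj') where
  cofibration _ _ f hf := h'.cofibration _ (h.cofibration f hf)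
  trivialCofibration _ _ f hf hf' :=
    h'.trivialCofibration _ (h.trivialCofibration f hf hf').1 (h.trivialCofibration f hf hf').2

/-- If the right adjoint preserves and detects weak equivalences, then a Quillen adjunction is a
Quillen equivalence if and only if its unit is a weak equivalence at cofibrant objects. -/
lemma IsQuillenAdjunction.isQuillenEquivalence_iff (h : IsQuillenAdjunction adj)
    (hR : ∀ ⦃X Y : B⦄ (f : X ⟶ Y), WeakEquivalence (R.map f) ↔ WeakEquivalence f) :
    IsQuillenEquivalence adj ↔ ∀ X : A, IsCofibrant X → WeakEquivalence (adj.unit.app X) := by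
  constructor
  · intro h' X hX
    -- The adjunct of `j` is the unit followed by `R.map j`, so two out of three isolates the unit.
    obtain ⟨Y, j, hY, _, hj⟩ := exists_fibrant_resolution (L.obj X)
    have := (hR j).2 hj
    have := (h'.weakEquivalence_iff hX hY j).1 hj
    rw [adj.homEquiv_unit] at this
    exact weakEquivalence_of_postcomp (adj.unit.app X) (R.map j)
  · intro h'
    refine ⟨h, fun X Y hX hY f => ?_⟩
    have := h' X hX
    rw [adj.homEquiv_unit, weakEquivalence_precomp_iff, hR]

end QuillenEquivalences

/-! ### The unit of the restriction adjunction and the main theorem -/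

section ProjectiveModelStructure

variable {V : Type u} [Category.{v} V] [MonoidalCategory V] [SymmetricCategory V]
  [MonoidalClosed V] [ModelCategory V] {C D : Type v} [EnrichedCategory V C] [EnrichedCategory V D]

namespace IsProjectiveModelStructure

open VPresheaf

lemma isQuillenAdjunction_free [MC : ModelCategory (VPresheaf V C)]
    (hMC : IsProjectiveModelStructure MC) (c : C) : IsQuillenAdjunction (freeAdjunction (V := V) c) :=
  isQuillenAdjunction_of_rightAdjoint
    (fun _ _ p hp => (hMC.fibration_iff p).1 hp c)
    (fun _ _ p _ hp => (hMC.weakEquivalence_iff p).1 hp c)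

lemma isQuillenAdjunction_cofree [MC : ModelCategory (VPresheaf V C)]
    (hMC : IsProjectiveModelStructure MC) (hC : IsLocallyFlat V C) (c : C) :
    IsQuillenAdjunction (cofreeAdjunction (V := V) c) :=
  isQuillenAdjunction_of_rightAdjoint
    (fun _ _ p _ => (hMC.fibration_iff _).2 fun c' =>
      (hC c c').isQuillenAdjunction.fibration_map p)
    (fun _ _ p _ _ => (hMC.weakEquivalence_iff _).2 fun c' =>
      (hC c c').isQuillenAdjunction.weakEquivalence_map_of_fibration p)

variable [MD : ModelCategory (VPresheaf V D)] (hMD : IsProjectiveModelStructure MD)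
  [MC : ModelCategory (VPresheaf V C)] (hMC : IsProjectiveModelStructure MC)
  {F : EnrichedFunctor V D C}

include hMD hMC

lemma isQuillenAdjunction_restriction {L : VPresheaf V D ⥤ VPresheaf V C}
    (adj : L ⊣ restriction F) : IsQuillenAdjunction adj :=
  isQuillenAdjunction_of_rightAdjoint
    (fun _ _ p hp => (hMD.fibration_iff _).2 fun d => (hMC.fibration_iff p).1 hp (F.obj d))
    (fun _ _ p _ hp => (hMD.weakEquivalence_iff _).2 fun d =>
      (hMC.weakEquivalence_iff p).1 hp (F.obj d))

lemma weakEquivalence_restriction_map_iff (hF : Function.Surjective F.obj) {X Y : VPresheaf V C}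
    (f : X ⟶ Y) : WeakEquivalence ((restriction F).map f) ↔ WeakEquivalence f := by
  rw [hMD.weakEquivalence_iff, hMC.weakEquivalence_iff]
  exact (hF.forall (p := fun c => WeakEquivalence (f.app c))).symm

end IsProjectiveModelStructure

namespace VPresheaf

/-- The morphism `[C(F d, F -), Y] ⟶ [D(d, -), Y]` induced by `F`. -/
def cofreeRestriction (F : EnrichedFunctor V D C) (d : D) (Y : V) :
    (restriction F).obj ((cofree (F.obj d)).obj Y) ⟶ (cofree d).obj Y :=
  cofreeLift (X := (restriction F).obj ((cofree (F.obj d)).obj Y)) (cofreeCounit (F.obj d) Y)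

omit [ModelCategory V] in
lemma cofreeRestriction_app (F : EnrichedFunctor V D C) (d d' : D) (Y : V) :
    (cofreeRestriction F d Y).app d' = (MonoidalClosed.pre (F.map d d')).app Y := by
  have h : F.map d d' ▷ ((cofree (F.obj d)).obj Y).val (F.obj d') ≫
      ((cofree (F.obj d)).obj Y).lact (F.obj d') (F.obj d) ≫ cofreeCounit (F.obj d) Y =
      MonoidalClosed.uncurry ((MonoidalClosed.pre (F.map d d')).app Y) := by
    rw [lact_cofreeCounit, MonoidalClosed.uncurry_pre]
    rfl
  exact (congrArg MonoidalClosed.curry (((congrArg (· ≫ cofreeCounit (F.obj d) Y)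
    (restriction_lact F _ d' d)).trans (Category.assoc _ _ _)).trans h)).trans
    (MonoidalClosed.curry_uncurry _)

/-- The morphism `D(-, d) ⊗ A ⟶ C(F -, F d) ⊗ A` induced by `F`. -/
def freeRestriction (F : EnrichedFunctor V D C) (d : D) (A : V) :
    (free d).obj A ⟶ (restriction F).obj ((free (F.obj d)).obj A) :=
  freeDesc (X := (restriction F).obj ((free (F.obj d)).obj A)) (freeUnit (F.obj d) A)

omit [ModelCategory V] in
lemma freeRestriction_app (F : EnrichedFunctor V D C) (d d' : D) (A : V) :
    (freeRestriction F d A).app d' = F.map d' d ▷ A := by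
  have h : (d' ⟶[V] d) ◁ freeUnit (F.obj d) A ≫
      F.map d' d ▷ ((free (F.obj d)).obj A).val (F.obj d) ≫
        ((free (F.obj d)).obj A).lact (F.obj d) (F.obj d') = F.map d' d ▷ A := by
    rw [whisker_exchange_assoc, freeUnit_lact]
    exact Category.comp_id _
  exact (congrArg (_ ≫ ·) (restriction_lact F _ d d')).trans h

-- `L` is an arbitrary left adjoint, so its value on a free presheaf is identified by both objects
-- corepresenting the same functor.
omit [ModelCategory V] in
lemma isIso_homEquiv_symm_freeRestriction {F : EnrichedFunctor V D C}
    {L : VPresheaf V D ⥤ VPresheaf V C} (adj : L ⊣ restriction F) (d : D) (A : V) :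
    IsIso ((adj.homEquiv _ _).symm (freeRestriction F d A)) := by
  refine isIso_of_coyoneda_map_bijective _ fun Z => ?_
  have e (g : (free (F.obj d)).obj A ⟶ Z) :
      adj.homEquiv _ _ ((adj.homEquiv _ _).symm (freeRestriction F d A) ≫ g) =
        (corepresentableByFree F d A).homEquiv g := by
    rw [adj.homEquiv_naturality_right, Equiv.apply_symm_apply]
    exact freeAdjunction_homEquiv_symm_comp d
      (X := (restriction F).obj ((free (F.obj d)).obj A)) _ ((restriction F).map g)
  rw [← (adj.homEquiv _ _).bijective.of_comp_iff' (f := adj.homEquiv _ _)]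
  have h := (corepresentableByFree F d A).homEquiv (Y := Z).bijective
  rw [← funext e] at h
  exact h

omit [ModelCategory V] in
lemma comp_cofreeLift {X X' : VPresheaf V C} (g : X' ⟶ X) {c : C} {Y : V} (f : X.val c ⟶ Y) :
    g ≫ cofreeLift f = cofreeLift (g.app c ≫ f) := by
  rw [← cofreeAdjunction_homEquiv_apply, ← cofreeAdjunction_homEquiv_apply]
  exact ((cofreeAdjunction c).homEquiv_naturality_left g f).symm

-- With `g` the unit of the adjunction, this is the conjugacy relation needed in
-- `weakEquivalence_unit_app`.
omit [ModelCategory V] in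
lemma cofreeLift_comp {F : EnrichedFunctor V D C} {X : VPresheaf V D} {Z : VPresheaf V C}
    (g : X ⟶ (restriction F).obj Z) {d : D} {Y : V} (f : Z.val (F.obj d) ⟶ Y) :
    cofreeLift (g.app d ≫ f) =
      (g ≫ (restriction F).map (cofreeLift f)) ≫ cofreeRestriction F d Y := by
  refine Eq.trans ?_ (comp_cofreeLift (X := (restriction F).obj ((cofree (F.obj d)).obj Y))
    (g ≫ (restriction F).map (cofreeLift f)) (cofreeCounit (F.obj d) Y)).symm
  exact congrArg cofreeLift ((Category.assoc _ _ _).trans (congrArg (g.app d ≫ ·)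
    (cofreeLift_cofreeCounit f))).symm

end VPresheaf

namespace IsProjectiveModelStructure

open VPresheaf

variable [MD : ModelCategory (VPresheaf V D)] (hMD : IsProjectiveModelStructure MD)
  [MC : ModelCategory (VPresheaf V C)] (hMC : IsProjectiveModelStructure MC)
  (hV : IsMonoidalModelCategory V) (hD : IsLocallyFlat V D) (hC : IsLocallyFlat V C)
  {F : EnrichedFunctor V D C} {L : VPresheaf V D ⥤ VPresheaf V C} (adj : L ⊣ restriction F)

include hMD hMC hV hD hC

lemma weakEquivalence_unit_app (hF : IsHomotopicallyFullyFaithful F) (X : VPresheaf V D)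
    [IsCofibrant X] : WeakEquivalence (adj.unit.app X) := by
  rw [hMD.weakEquivalence_iff]
  intro d
  refine (hMD.isQuillenAdjunction_cofree hD d).weakEquivalence_of_conjugate
    ((hMD.isQuillenAdjunction_restriction hMC adj).comp
      (hMC.isQuillenAdjunction_cofree hC (F.obj d))) X ((adj.unit.app X).app d)
    (cofreeRestriction F d) (fun Y f => ?_) (fun Y hY => ?_)
  · rw [Adjunction.comp_homEquiv]
    refine (cofreeAdjunction_homEquiv_apply d (X := X) _).trans
      ((cofreeLift_comp (adj.unit.app X) f).trans (congrArg (· ≫ cofreeRestriction F d Y) ?_))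
    exact ((adj.homEquiv_unit X _ _).trans (congrArg (fun t => adj.unit.app X ≫ (restriction F).map t)
      (cofreeAdjunction_homEquiv_apply (F.obj d) f))).symm
  · rw [hMD.weakEquivalence_iff]
    intro d'
    have := hF d d'
    rw [cofreeRestriction_app]
    -- Full faithfulness is used here: the conjugate map is restriction of internal homs along a
    -- weak equivalence of flat objects.
    exact hV.weakEquivalence_pre_app (hD d d') (hC _ _) (F.map d d') Y

omit MC hMC in
lemma isHomotopicallyFullyFaithful
    (h : ∀ X : VPresheaf V D, IsCofibrant X → WeakEquivalence (adj.unit.app X)) :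
    IsHomotopicallyFullyFaithful F := by
  intro d' d
  -- The representable presheaf itself need not be cofibrant, as the monoidal unit need not be.
  -- Tensoring it with `Q` repairs this without losing information about maps of flat objects.
  obtain ⟨Q, q, _, _, _⟩ := exists_cofibrant_resolution (𝟙_ V)
  have := h _ ((hMD.isQuillenAdjunction_free d).isCofibrant_obj Q)
  have := isIso_homEquiv_symm_freeRestriction adj d Q
  have : WeakEquivalence (freeRestriction F d Q) := by
    rw [← (adj.homEquiv _ _).apply_symm_apply (freeRestriction F d Q), adj.homEquiv_unit]
    infer_instance
  have := (hMD.weakEquivalence_iff _).1 this d'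
  rw [freeRestriction_app] at this
  exact (hV.weakEquivalence_whiskerRight_iff q (hD _ _) (hC _ _) _).1 this

end IsProjectiveModelStructure

end ProjectiveModelStructure

theorem mainTheorem8 (V : Type u) [Category.{v} V] [MonoidalCategory V] [SymmetricCategory V]
    [MonoidalClosed V] [HasLimits V] [HasColimits V] [ModelCategory V]
    (hcg : IsCofibrantlyGenerated V) (hV : IsMonoidalModelCategory V)
    (D C : Type v) [EnrichedCategory V D] [EnrichedCategory V C]
    (hD : IsLocallyFlat V D) (hC : IsLocallyFlat V C)
    (F : EnrichedFunctor V D C) (hF : Function.Surjective F.obj) :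
    (∃ M : ModelCategory (VPresheaf V D), IsProjectiveModelStructure M) ∧
    (∃ M : ModelCategory (VPresheaf V C), IsProjectiveModelStructure M) ∧
    (restriction F).IsRightAdjoint ∧
    ∀ (MD : ModelCategory (VPresheaf V D)) (MC : ModelCategory (VPresheaf V C)),
      IsProjectiveModelStructure MD → IsProjectiveModelStructure MC →
      ∀ (L : VPresheaf V D ⥤ VPresheaf V C) (adj : L ⊣ restriction F),
        IsQuillenAdjunction adj ∧
        (IsQuillenEquivalence adj ↔ IsHomotopicallyFullyFaithful F) := by
  refine ⟨exists_isProjectiveModelStructure hcg hD, exists_isProjectiveModelStructure hcg hC,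
    inferInstance, fun MD MC hMD hMC L adj => ?_⟩
  have h := hMD.isQuillenAdjunction_restriction hMC adj
  refine ⟨h, ?_⟩
  rw [h.isQuillenEquivalence_iff fun _ _ => hMD.weakEquivalence_restriction_map_iff hMC hF]
  exact ⟨hMD.isHomotopicallyFullyFaithful hV hD hC adj,
    fun hF' X _ => hMD.weakEquivalence_unit_app hMC hV hD hC adj hF' X⟩
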